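/- **Theorem.** Let $k\ge 1$, let $\Lambda$ be a row-finite $k$-graph without sources and let $\mathsf k$ be any field. Then the following conditions are equivalent. 1. The Kumjian–Pask algebra $\operatorname{KP}_{\mathsf k}(\Lambda)$ is semisimple. 2. The talented monoid $T_\Lambda$ is atomic and $\mathbb Z^k$ acts freely on $T_\Lambda$. 3. $T_\Lambda$ is atomic and every atom of $T_\Lambda$ is aperiodic. 4. The smallest hereditary and saturated subset of $\Lambda^0$ that contains all leaves is $\Lambda^0$, and $\Lambda$ is aperiodic. Here the terms have the following meaning. * A *$k$-graph* is a countable small category $\Lambda$ with object set $\Lambda^0$ (the vertices), range and source maps $r,s$ and a functor $d:\Lambda\to\mathbb N^k$ such that every $\lambda$ with $d(\lambda)=m+n$ factors in exactly one way as $\lambda=\mu\nu$ with $d(\mu)=m$, $d(\nu)=n$; the product $\mu\nu$ is defined when $s(\mu)=r(\nu)$. Write $v\Lambda^n=\{\lambda: r(\lambda)=v,\ d(\lambda)=n\}$. *Row-finite without sources* means that $v\Lambda^n$ is finite and nonempty for all $v\in\Lambda^0$, $n\in\mathbb N^k$. * $\operatorname{KP}_{\mathsf k}(\Lambda)$ is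 the (not necessarily unital) $\mathsf k$-algebra generated by elements $p_v$ ($v\in\Lambda^0$), $s_\lambda$, $s_{\lambda^*}$ ($\lambda\in\Lambda$), with $s_v=s_{v^*}=p_v$, subject to the relations: $p_up_v=\delta_{u,v}p_u$; $s_\lambda s_\mu=s_{\lambda\mu}$ and $s_{\mu^*}s_{\lambda^*}=s_{(\lambda\mu)^*}$ if $s(\lambda)=r(\mu)$; $p_{r(\lambda)}s_\lambda=s_\lambda=s_\lambda p_{s(\lambda)}$ and $p_{s(\lambda)}s_{\lambda^*}=s_{\lambda^*}=s_{\lambda^*}p_{r(\lambda)}$; $s_{\lambda^*}s_\mu=\delta_{\lambda,\mu}p_{s(\lambda)}$ if $d(\lambda)=d(\mu)$; $p_v=\sum_{\lambda\in v\Lambda^n}s_\lambda s_{\lambda^*}$ for all $v\in\Lambda^0$, $n\in\mathbb N^k$. It is *semisimple* if it is the sum of its minimal left ideals. * $T_\Lambda$ is the commutative monoid generated by the symbols $v(n)$ ($v\in\Lambda^0$, $n\in\mathbb Z^k$) subject to the relations $v(n)=\sum_{\alpha\in v\Lambda^{e_i}}s(\alpha)(n+e_i)$ for $v\in\Lambda^0$,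 $n\in\mathbb Z^k$, $1\le i\le k$, with the action of $\mathbb Z^k$ given by ${}^m v(n)=v(m+n)$. An *atom* of $T_\Lambda$ is a nonunit $a$ such that $a=b+c$ implies that $b$ or $c$ is a unit (invertible), and $T_\Lambda$ is *atomic* if every nonunit is a finite sum of atoms. A nonzero $a\in T_\Lambda$ is *periodic* if ${}^m a=a$ for some $m\ne 0$ in $\mathbb Z^k$, and *aperiodic* otherwise; $\mathbb Z^k$ acts *freely* on $T_\Lambda$ if $T_\Lambda$ has no periodic element. * A set $H\subseteq\Lambda^0$ is *hereditary* if $r(\lambda)\in H$ implies $s(\lambda)\in H$, and *saturated* if $s(v\Lambda^n)\subseteq H$ for some $n\in\mathbb N^k$ implies $v\in H$. A vertex $v$ is a *leaf* if $|v\Lambda^m|=1$ for all $m\in\mathbb N^k$. * $\Lambda$ is *aperiodic* if for any two distinct paths $\alpha\neq\beta$ in $\Lambda$ with $s(\alpha)=s(\beta)$ there is a path $\tau$ with $r(\tau)=s(\alpha)$ such that $\alpha\tau$ and $\beta\tau$ have no minimal common extension, that is, no path of degree $d(\alpha\tau)\vee d(\beta\tau)$ can be written both as $\alpha\tau\mu$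 and as $\beta\tau\nu$ with $\mu,\nu\in\Lambda$. -/

import Mathlib

open CategoryTheory

universe u w

noncomputable section

/-! ## Higher-rank graphs -/

/-- A path of a category `V`: a morphism `hom : src ⟶ rng` together with its source and its range.
Paths compose as functions do: if `s(p) = r(q)`, the path `pq` is `q.hom ≫ p.hom`. -/
@[ext]
structure GPath (V : Type u) [Category.{w} V] where
  /-- the source `s(p)` -/
  src : V
  /-- the range `r(p)` -/
  rng : V
  /-- the underlying morphism -/
  hom : src ⟶ rng

/-- A morphism, regarded as a path. -/
def GPath.of {V : Type u} [Category.{w} V] {a b : V} (f : a ⟶ b) : GPath V := ⟨a, b, f⟩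

/-- A `k`-graph: a countable category with a degree functor to `ℕ^k` that has the unique
factorization property. The objects are the vertices. -/
structure KGraph (k : ℕ) (V : Type u) [Category.{w} V] where
  /-- the degree functor, on morphisms -/
  deg : ∀ {a b : V}, (a ⟶ b) → (Fin k → ℕ)
  countable_path : Countable (GPath V)
  deg_id : ∀ a : V, deg (𝟙 a) = 0
  deg_comp : ∀ {a b c : V} (g : a ⟶ b) (f : b ⟶ c), deg (g ≫ f) = deg f + deg g
  /-- if `d(f) = m + n`, then `f = p₁ p₂` with `d(p₁) = m`, `d(p₂) = n` in exactly one way -/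
  factorization : ∀ {a b : V} (f : a ⟶ b) (m n : Fin k → ℕ), deg f = m + n →
    ∃! p : (c : V) × (c ⟶ b) × (a ⟶ c), p.2.2 ≫ p.2.1 = f ∧ deg p.2.1 = m ∧ deg p.2.2 = n

namespace KGraph

variable {k : ℕ} {V : Type u} [Category.{w} V] (Λ : KGraph k V)

/-- The degree of a path. -/
def degree (p : GPath V) : Fin k → ℕ := Λ.deg p.hom

/-- The set `vΛⁿ` of the paths with range `v` and degree `n`. -/
def pathsTo (v : V) (n : Fin k → ℕ) : Set (GPath V) := {p | p.rng = v ∧ Λ.degree p = n}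

/-- Row-finite: every `vΛⁿ` is finite. -/
def RowFinite : Prop := ∀ (v : V) (n : Fin k → ℕ), (Λ.pathsTo v n).Finite

/-- No sources: every `vΛⁿ` is nonempty. -/
def NoSources : Prop := ∀ (v : V) (n : Fin k → ℕ), (Λ.pathsTo v n).Nonempty

/-- `t` extends `p`, that is, `t = pq` for some path `q`. If `d(t) ≥ d(p)`, this says
`t(0, d(p)) = p`. -/
def Extends (t p : GPath V) : Prop := ∃ (c : V) (q : c ⟶ p.src), t = GPath.of (q ≫ p.hom)

/-- The set `MCE(p, q)` of the minimal common extensions of `p` and `q`. -/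
def MCE (p q : GPath V) : Set (GPath V) :=
  {t | Λ.degree t = Λ.degree p ⊔ Λ.degree q ∧ Extends t p ∧ Extends t q}

/-- Aperiodicity (the finite path formulation of Lewin and Sims): for any two distinct paths
`α ≠ β` with the same source there is a path `τ` with range `s(α)` such that `ατ` and `βτ` have no
minimal common extension. -/
def Aperiodic : Prop :=
  ∀ (a b c : V) (α : a ⟶ b) (β : a ⟶ c), GPath.of α ≠ GPath.of β →
    ∃ (e : V) (τ : e ⟶ a), Λ.MCE (GPath.of (τ ≫ α)) (GPath.of (τ ≫ β)) = ∅

/-- `H` is hereditary: `r(p) ∈ H` implies `s(p) ∈ H`. -/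
def Hereditary (_Λ : KGraph k V) (H : Set V) : Prop := ∀ p : GPath V, p.rng ∈ H → p.src ∈ H

/-- `H` is saturated: `s(vΛⁿ) ⊆ H` implies `v ∈ H`. -/
def Saturated (H : Set V) : Prop :=
  ∀ (v : V) (n : Fin k → ℕ), GPath.src '' Λ.pathsTo v n ⊆ H → v ∈ H

/-- The smallest hereditary and saturated set of vertices that contains `X`. -/
def hsClosure (X : Set V) : Set V := ⋂₀ {H | Λ.Hereditary H ∧ Λ.Saturated H ∧ X ⊆ H}

/-- The set of the leaves: the vertices `v` with `|vΛᵐ| = 1` for all `m`. -/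
def leaves : Set V := {v | ∀ m : Fin k → ℕ, (Λ.pathsTo v m).ncard = 1}

/-! ## The talented monoid -/

/-- The free commutative monoid on the symbols `v(n)`, `v` a vertex and `n ∈ ℤ^k`. -/
abbrev FreeT (_Λ : KGraph k V) : Type u := (V × (Fin k → ℤ)) →₀ ℕ

/-- The generator `v(n)` of the free commutative monoid. -/
def gen (v : V) (n : Fin k → ℤ) : Λ.FreeT := Finsupp.single (v, n) 1

/-- The defining relations `v(n) = ∑_{α ∈ vΛ^{e_i}} s(α)(n + e_i)` (if `vΛ^{e_i} ≠ ∅`). The sum is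
over a finite set if `Λ` is row-finite. -/
inductive TRel : Λ.FreeT → Λ.FreeT → Prop
  | mk (v : V) (n : Fin k → ℤ) (i : Fin k) (h : (Λ.pathsTo v (Pi.single i 1)).Nonempty) :
      TRel (Λ.gen v n) (∑ᶠ α ∈ Λ.pathsTo v (Pi.single i 1), Λ.gen α.src (n + Pi.single i 1))

/-- The talented monoid `T_Λ`. -/
def TMonoid : Type u := (addConGen Λ.TRel).Quotient

instance : AddCommMonoid Λ.TMonoid := inferInstanceAs (AddCommMonoid (addConGen Λ.TRel).Quotient)

/-- The quotient map from the free commutative monoid to `T_Λ`. -/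
def toT : Λ.FreeT →+ Λ.TMonoid := (addConGen Λ.TRel).mk'

/-- The shift `v(n) ↦ v(m + n)` of the free commutative monoid. -/
def freeShift (m : Fin k → ℤ) : Λ.FreeT →+ Λ.FreeT :=
  Finsupp.mapDomain.addMonoidHom (fun x => (x.1, m + x.2))

theorem freeShift_gen (m : Fin k → ℤ) (v : V) (n : Fin k → ℤ) :
    Λ.freeShift m (Λ.gen v n) = Λ.gen v (m + n) := by
  simp only [freeShift, gen, Finsupp.mapDomain.addMonoidHom_apply, Finsupp.mapDomain_single]

theorem toT_rel {x y : Λ.FreeT} (h : Λ.TRel x y) : Λ.toT x = Λ.toT y :=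
  (AddCon.eq _).2 (AddConGen.Rel.of _ _ h)

theorem toT_freeShift_rel (m : Fin k → ℤ) {x y : Λ.FreeT} (h : Λ.TRel x y) :
    Λ.toT (Λ.freeShift m x) = Λ.toT (Λ.freeShift m y) := by
  obtain ⟨v, n, i, h⟩ := h
  rw [freeShift_gen]
  by_cases hf : (Λ.pathsTo v (Pi.single i 1)).Finite
  · rw [(Λ.freeShift m).map_finsum_mem _ hf]
    simp only [freeShift_gen, ← add_assoc]
    exact Λ.toT_rel (TRel.mk v (m + n) i h)
  · have h0 (n' : Fin k → ℤ) :
        ∑ᶠ α ∈ Λ.pathsTo v (Pi.single i 1), Λ.gen α.src (n' + Pi.single i 1) = 0 := by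
      refine finsum_mem_eq_zero_of_infinite ?_
      rw [show Function.support (fun α : GPath V => Λ.gen α.src (n' + Pi.single i 1)) = Set.univ
        from Set.eq_univ_of_forall fun α => by simp [gen]]
      rw [Set.inter_univ]
      exact hf
    rw [h0, map_zero, map_zero, ← map_zero Λ.toT, ← h0 (m + n)]
    exact Λ.toT_rel (TRel.mk v (m + n) i h)

/-- The state shift `v(n) ↦ v(m + n)` on the talented monoid. -/
def shift (m : Fin k → ℤ) : Λ.TMonoid →+ Λ.TMonoid :=
  (addConGen Λ.TRel).lift (Λ.toT.comp (Λ.freeShift m))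
    (AddCon.addConGen_le.2 fun _ _ h => Λ.toT_freeShift_rel m h)

theorem shift_toT (m : Fin k → ℤ) (x : Λ.FreeT) :
    Λ.shift m (Λ.toT x) = Λ.toT (Λ.freeShift m x) := rfl

/-- The action of `ℤ^k` (written multiplicatively) on `T_Λ` by monoid automorphisms,
`m • v(n) = v(m + n)`. -/
instance : DistribMulAction (Multiplicative (Fin k → ℤ)) Λ.TMonoid where
  smul m a := Λ.shift m.toAdd a
  one_smul a := by
    obtain ⟨x, rfl⟩ := Quotient.exists_rep a
    change Λ.shift 0 (Λ.toT x) = Λ.toT x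
    rw [shift_toT]
    congr 1
    simp only [freeShift, zero_add, Prod.mk.eta, Finsupp.mapDomain.addMonoidHom_apply]
    exact Finsupp.mapDomain_id
  mul_smul m n a := by
    obtain ⟨x, rfl⟩ := Quotient.exists_rep a
    change Λ.shift (m.toAdd + n.toAdd) (Λ.toT x) = Λ.shift m.toAdd (Λ.shift n.toAdd (Λ.toT x))
    simp only [shift_toT]
    congr 1
    simp only [freeShift, Finsupp.mapDomain.addMonoidHom_apply, ← Finsupp.mapDomain_comp]
    congr 1
    funext y
    simp [add_assoc]
  smul_zero m := map_zero (Λ.shift m.toAdd)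
  smul_add m := map_add (Λ.shift m.toAdd)

end KGraph

/-! ## Commutative monoids with a group action -/

/-- A commutative monoid is atomic if every nonunit is a finite sum of atoms. An atom is a nonunit
`a` such that `a = b + c` implies that `b` or `c` is a unit. -/
def IsAtomicMonoid (M : Type*) [AddCommMonoid M] : Prop :=
  ∀ a : M, ¬ IsAddUnit a → ∃ s : Multiset M, (∀ b ∈ s, AddIrreducible b) ∧ s.sum = a

/-- A nonzero element is periodic if some nontrivial group element fixes it. -/
def IsPeriodicElt (Γ : Type*) {M : Type*} [Group Γ] [AddCommMonoid M] [DistribMulAction Γ M]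
    (a : M) : Prop := a ≠ 0 ∧ ∃ γ : Γ, γ ≠ 1 ∧ γ • a = a

/-- A nonzero element is aperiodic if it is not periodic. -/
def IsAperiodicElt (Γ : Type*) {M : Type*} [Group Γ] [AddCommMonoid M] [DistribMulAction Γ M]
    (a : M) : Prop := a ≠ 0 ∧ ¬ IsPeriodicElt Γ a

/-- The group acts freely on the monoid if there is no periodic element. -/
def ActsFreely (Γ : Type*) (M : Type*) [Group Γ] [AddCommMonoid M] [DistribMulAction Γ M] : Prop :=
  ∀ a : M, ¬ IsPeriodicElt Γ a

/-! ## Semisimple rings, possibly without identity -/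

/-- Left ideals of a ring that need not have an identity. -/
def IsLeftIdeal {A : Type*} [NonUnitalRing A] (I : AddSubgroup A) : Prop :=
  ∀ a x : A, x ∈ I → a * x ∈ I

/-- Minimal left ideals: the minimal ones among the nonzero left ideals. -/
def IsMinimalLeftIdeal {A : Type*} [NonUnitalRing A] (I : AddSubgroup A) : Prop :=
  Minimal (fun J : AddSubgroup A => IsLeftIdeal J ∧ J ≠ ⊥) I

/-- The (left) socle: the sum of all minimal left ideals. -/
def leftSocle (A : Type*) [NonUnitalRing A] : AddSubgroup A :=
  sSup {I : AddSubgroup A | IsMinimalLeftIdeal I}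

/-- A ring, possibly without identity, is semisimple if it is the sum of its minimal left ideals. -/
def IsSemisimpleNonUnital (A : Type*) [NonUnitalRing A] : Prop := leftSocle A = ⊤

/-! ## The Kumjian-Pask algebra -/

namespace KGraph

variable {k : ℕ} {V : Type u} [Category.{w} V] (Λ : KGraph k V)

/-- Kumjian-Pask `Λ`-families in an `R`-algebra `A` that need not have an identity. The maps `S` and
`Sst` (the values at the ghost paths) are extended to the paths of degree `0`, that is, to the
identities, by the usual convention `S_v = S_{v*} = P_v`. -/
structure KPFamily (A : Type*) [NonUnitalRing A] where
  /-- the elements `P_v` -/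
  P : V → A
  /-- the elements `S_p` -/
  S : GPath V → A
  /-- the elements `S_{p*}` -/
  Sst : GPath V → A
  S_id : ∀ v, S (GPath.of (𝟙 v)) = P v
  Sst_id : ∀ v, Sst (GPath.of (𝟙 v)) = P v
  P_mul_self : ∀ v, P v * P v = P v
  P_mul_ne : ∀ v v', v ≠ v' → P v * P v' = 0
  S_mul : ∀ {a b c : V} (p : b ⟶ c) (q : a ⟶ b),
    S (GPath.of p) * S (GPath.of q) = S (GPath.of (q ≫ p))
  Sst_mul : ∀ {a b c : V} (p : b ⟶ c) (q : a ⟶ b),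
    Sst (GPath.of q) * Sst (GPath.of p) = Sst (GPath.of (q ≫ p))
  P_mul_S : ∀ p : GPath V, P p.rng * S p = S p
  S_mul_P : ∀ p : GPath V, S p * P p.src = S p
  P_mul_Sst : ∀ p : GPath V, P p.src * Sst p = Sst p
  Sst_mul_P : ∀ p : GPath V, Sst p * P p.rng = Sst p
  Sst_mul_S_self : ∀ p : GPath V, Sst p * S p = P p.src
  Sst_mul_S_ne : ∀ p q : GPath V, Λ.degree p = Λ.degree q → p ≠ q → Sst p * S q = 0
  P_eq_sum : ∀ (v : V) (n : Fin k → ℕ), P v = ∑ᶠ p ∈ Λ.pathsTo v n, S p * Sst p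

/-- The generators of the Kumjian-Pask algebra: vertices, paths, and ghost paths. -/
inductive KPGen (_Λ : KGraph k V) : Type (max u w)
  | vertex (v : V) : KPGen _Λ
  | path (p : GPath V) : KPGen _Λ
  | ghost (p : GPath V) : KPGen _Λ

variable (R : Type*) [CommRing R]

section Relations

variable {R}

/-- A vertex as an element of the free algebra. -/
def fv (v : V) : FreeAlgebra R Λ.KPGen := FreeAlgebra.ι R (KPGen.vertex v)
/-- A path as an element of the free algebra. -/
def fp (p : GPath V) : FreeAlgebra R Λ.KPGen := FreeAlgebra.ι R (KPGen.path p)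
/-- A ghost path as an element of the free algebra. -/
def fg (p : GPath V) : FreeAlgebra R Λ.KPGen := FreeAlgebra.ι R (KPGen.ghost p)

end Relations

/-- The Kumjian-Pask relations in the free algebra on the vertices, paths and ghost paths. -/
inductive KPRel : FreeAlgebra R Λ.KPGen → FreeAlgebra R Λ.KPGen → Prop
  | path_id (v : V) : KPRel (Λ.fp (GPath.of (𝟙 v))) (Λ.fv v)
  | ghost_id (v : V) : KPRel (Λ.fg (GPath.of (𝟙 v))) (Λ.fv v)
  | vertex_self (v : V) : KPRel (Λ.fv v * Λ.fv v) (Λ.fv v)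
  | vertex_ne (v v' : V) (h : v ≠ v') : KPRel (Λ.fv v * Λ.fv v') 0
  | path_mul {a b c : V} (p : b ⟶ c) (q : a ⟶ b) :
      KPRel (Λ.fp (GPath.of p) * Λ.fp (GPath.of q)) (Λ.fp (GPath.of (q ≫ p)))
  | ghost_mul {a b c : V} (p : b ⟶ c) (q : a ⟶ b) :
      KPRel (Λ.fg (GPath.of q) * Λ.fg (GPath.of p)) (Λ.fg (GPath.of (q ≫ p)))
  | vertex_path (p : GPath V) : KPRel (Λ.fv p.rng * Λ.fp p) (Λ.fp p)
  | path_vertex (p : GPath V) : KPRel (Λ.fp p * Λ.fv p.src) (Λ.fp p)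
  | vertex_ghost (p : GPath V) : KPRel (Λ.fv p.src * Λ.fg p) (Λ.fg p)
  | ghost_vertex (p : GPath V) : KPRel (Λ.fg p * Λ.fv p.rng) (Λ.fg p)
  | ghost_path_self (p : GPath V) : KPRel (Λ.fg p * Λ.fp p) (Λ.fv p.src)
  | ghost_path_ne (p q : GPath V) (hd : Λ.degree p = Λ.degree q) (h : p ≠ q) :
      KPRel (Λ.fg p * Λ.fp q) 0
  | vertex_sum (v : V) (n : Fin k → ℕ) :
      KPRel (Λ.fv v) (∑ᶠ p ∈ Λ.pathsTo v n, Λ.fp p * Λ.fg p)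

/-- The algebra with identity that is generated by the vertices, paths and ghost paths subject to
the Kumjian-Pask relations. It is the unitization of the Kumjian-Pask algebra. -/
abbrev KPUnital := RingQuot (Λ.KPRel R)

/-- The image of a generator. -/
def kpGen (x : Λ.KPGen) : Λ.KPUnital R := RingQuot.mkAlgHom R (Λ.KPRel R) (FreeAlgebra.ι R x)

/-- The Kumjian-Pask algebra `KP_R(Λ)`: the `R`-algebra (without a prescribed identity) generated by
the vertices, paths and ghost paths subject to the Kumjian-Pask relations. Its universal property is
`kumjianPask_universal` below. -/
def KumjianPask : NonUnitalSubalgebra R (Λ.KPUnital R) :=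
  NonUnitalAlgebra.adjoin R (Set.range (Λ.kpGen R))

/-- A generator as an element of the Kumjian-Pask algebra. -/
def kp (x : Λ.KPGen) : Λ.KumjianPask R :=
  ⟨Λ.kpGen R x, NonUnitalAlgebra.subset_adjoin R (Set.mem_range_self x)⟩

/-- The canonical Kumjian-Pask family in the Kumjian-Pask algebra of a row-finite `k`-graph. -/
def kpFamily (h : Λ.RowFinite) : Λ.KPFamily (Λ.KumjianPask R) where
  P v := Λ.kp R (.vertex v)
  S p := Λ.kp R (.path p)
  Sst p := Λ.kp R (.ghost p)
  S_id v := Subtype.ext (RingQuot.mkAlgHom_rel R (.path_id v))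
  Sst_id v := Subtype.ext (RingQuot.mkAlgHom_rel R (.ghost_id v))
  P_mul_self v := Subtype.ext <| by
    simpa [kp, kpGen, fv] using RingQuot.mkAlgHom_rel R (KPRel.vertex_self (R := R) (Λ := Λ) v)
  P_mul_ne v v' hv := Subtype.ext <| by
    simpa [kp, kpGen, fv] using RingQuot.mkAlgHom_rel R (KPRel.vertex_ne (R := R) (Λ := Λ) v v' hv)
  S_mul p q := Subtype.ext <| by
    simpa [kp, kpGen, fp] using RingQuot.mkAlgHom_rel R (KPRel.path_mul (R := R) (Λ := Λ) p q)
  Sst_mul p q := Subtype.ext <| by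
    simpa [kp, kpGen, fg] using RingQuot.mkAlgHom_rel R (KPRel.ghost_mul (R := R) (Λ := Λ) p q)
  P_mul_S p := Subtype.ext <| by
    simpa [kp, kpGen, fv, fp] using RingQuot.mkAlgHom_rel R (KPRel.vertex_path (R := R) (Λ := Λ) p)
  S_mul_P p := Subtype.ext <| by
    simpa [kp, kpGen, fv, fp] using RingQuot.mkAlgHom_rel R (KPRel.path_vertex (R := R) (Λ := Λ) p)
  P_mul_Sst p := Subtype.ext <| by
    simpa [kp, kpGen, fv, fg] using RingQuot.mkAlgHom_rel R (KPRel.vertex_ghost (R := R) (Λ := Λ) p)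
  Sst_mul_P p := Subtype.ext <| by
    simpa [kp, kpGen, fv, fg] using RingQuot.mkAlgHom_rel R (KPRel.ghost_vertex (R := R) (Λ := Λ) p)
  Sst_mul_S_self p := Subtype.ext <| by
    simpa [kp, kpGen, fv, fp, fg] using
      RingQuot.mkAlgHom_rel R (KPRel.ghost_path_self (R := R) (Λ := Λ) p)
  Sst_mul_S_ne p q hd hpq := Subtype.ext <| by
    simpa [kp, kpGen, fp, fg] using
      RingQuot.mkAlgHom_rel R (KPRel.ghost_path_ne (R := R) (Λ := Λ) p q hd hpq)
  P_eq_sum v n := Subtype.ext <| by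
    have h1 := RingQuot.mkAlgHom_rel R (KPRel.vertex_sum (R := R) (Λ := Λ) v n)
    rw [finsum_mem_eq_finite_toFinset_sum _ (h v n)] at h1 ⊢
    simpa [kp, kpGen, fv, fp, fg] using h1

/-- The universal property of the Kumjian-Pask algebra of a row-finite `k`-graph, in the category of
`R`-algebras that need not have an identity. -/
theorem kumjianPask_universal (h : Λ.RowFinite) {A : Type*} [NonUnitalRing A] [Module R A]
    [IsScalarTower R A A] [SMulCommClass R A A] (F : Λ.KPFamily A) :
    ∃! φ : Λ.KumjianPask R →ₙₐ[R] A,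
      (∀ v, φ ((Λ.kpFamily R h).P v) = F.P v) ∧ (∀ p, φ ((Λ.kpFamily R h).S p) = F.S p) ∧
        ∀ p, φ ((Λ.kpFamily R h).Sst p) = F.Sst p := by
  let val : Λ.KPGen → A := fun x => match x with
    | .vertex v => F.P v
    | .path p => F.S p
    | .ghost p => F.Sst p
  let f : FreeAlgebra R Λ.KPGen →ₐ[R] Unitization R A :=
    FreeAlgebra.lift R fun x => (val x : Unitization R A)
  have fv' (v : V) : f (Λ.fv v) = (F.P v : Unitization R A) := by simp [f, fv, val]
  have fp' (p : GPath V) : f (Λ.fp p) = (F.S p : Unitization R A) := by simp [f, fp, val]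
  have fg' (p : GPath V) : f (Λ.fg p) = (F.Sst p : Unitization R A) := by simp [f, fg, val]
  have hrel : ∀ ⦃x y⦄, Λ.KPRel R x y → f x = f y := by
    intro x y hxy
    cases hxy with
    | path_id v => rw [fv', fp', F.S_id]
    | ghost_id v => rw [fv', fg', F.Sst_id]
    | vertex_self v => rw [map_mul, fv', ← Unitization.inr_mul, F.P_mul_self]
    | vertex_ne v v' hv =>
      rw [map_mul, fv', fv', ← Unitization.inr_mul, F.P_mul_ne _ _ hv, map_zero, Unitization.inr_zero]
    | path_mul p q => rw [map_mul, fp', fp', fp', ← Unitization.inr_mul, F.S_mul]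
    | ghost_mul p q => rw [map_mul, fg', fg', fg', ← Unitization.inr_mul, F.Sst_mul]
    | vertex_path p => rw [map_mul, fp', fv', ← Unitization.inr_mul, F.P_mul_S]
    | path_vertex p => rw [map_mul, fp', fv', ← Unitization.inr_mul, F.S_mul_P]
    | vertex_ghost p => rw [map_mul, fg', fv', ← Unitization.inr_mul, F.P_mul_Sst]
    | ghost_vertex p => rw [map_mul, fg', fv', ← Unitization.inr_mul, F.Sst_mul_P]
    | ghost_path_self p => rw [map_mul, fg', fp', fv', ← Unitization.inr_mul, F.Sst_mul_S_self]
    | ghost_path_ne p q hd hpq =>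
      rw [map_mul, fg', fp', ← Unitization.inr_mul, F.Sst_mul_S_ne p q hd hpq, map_zero,
        Unitization.inr_zero]
    | vertex_sum v n =>
      rw [fv', F.P_eq_sum v n, finsum_mem_eq_finite_toFinset_sum _ (h v n),
        finsum_mem_eq_finite_toFinset_sum _ (h v n), map_sum]
      simp only [map_mul, fp', fg', ← Unitization.inr_mul]
      exact map_sum (Unitization.inrNonUnitalAlgHom R A) _ _
  let g : Λ.KPUnital R →ₐ[R] Unitization R A := RingQuot.liftAlgHom R ⟨f, hrel⟩
  have hg (x : Λ.KPGen) : g (Λ.kpGen R x) = (val x : Unitization R A) := by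
    simp [g, kpGen, f]
  have hfst : ∀ x ∈ Λ.KumjianPask R, (g x).fst = 0 := by
    intro x hx
    induction hx using NonUnitalAlgebra.adjoin_induction with
    | mem x hx => obtain ⟨y, rfl⟩ := hx; simp [hg]
    | zero => simp
    | add x y _ _ hx hy => simp [hx, hy]
    | mul x y _ _ hx hy => simp [hx, hy]
    | smul r x _ hx => simp [hx]
  let φ : Λ.KumjianPask R →ₙₐ[R] A :=
    { toFun := fun x => (g x).snd
      map_smul' := fun r x => by simp
      map_zero' := by simp
      map_add' := fun x y => by simp
      map_mul' := fun x y => by simp [hfst x x.2, hfst y y.2] }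
  have hφ (x : Λ.KPGen) : φ (Λ.kp R x) = val x := by
    change (g (Λ.kpGen R x)).snd = val x
    rw [hg, Unitization.snd_inr]
  refine ⟨φ, ⟨fun v => hφ _, fun p => hφ _, fun p => hφ _⟩, ?_⟩
  rintro ψ ⟨h1, h2, h3⟩
  have hψ (x : Λ.KPGen) : ψ (Λ.kp R x) = φ (Λ.kp R x) := by
    rw [hφ]
    cases x with
    | vertex v => exact h1 v
    | path p => exact h2 p
    | ghost p => exact h3 p
  ext ⟨x, hx⟩
  induction hx using NonUnitalAlgebra.adjoin_induction with
  | mem x hx => obtain ⟨y, rfl⟩ := hx; exact hψ y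
  | zero => exact (map_zero ψ).trans (map_zero φ).symm
  | add x y hx hy ihx ihy =>
    exact (map_add ψ ⟨x, hx⟩ ⟨y, hy⟩).trans
      ((congrArg₂ (· + ·) ihx ihy).trans (map_add φ ⟨x, hx⟩ ⟨y, hy⟩).symm)
  | mul x y hx hy ihx ihy =>
    exact (map_mul ψ ⟨x, hx⟩ ⟨y, hy⟩).trans
      ((congrArg₂ (· * ·) ihx ihy).trans (map_mul φ ⟨x, hx⟩ ⟨y, hy⟩).symm)
  | smul r x hx ihx =>
    exact (map_smul ψ r ⟨x, hx⟩).trans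
      ((congrArg (r • ·) ihx).trans (map_smul φ r ⟨x, hx⟩).symm)

end KGraph

end

/-! Each of the four conditions amounts to `LeafBound` and `RigidLeaves` together: paths of large
degree into a given vertex have leaf sources, and a path into a leaf is determined by its two ends.

Combinatorics: the vertices with the first property form a hereditary saturated set, so `LeafBound`
is the condition on the closure. A separating path τ can then be chosen with a leaf as source, which
reduces aperiodicity to paths into leaves, that is, to rigidity.

Monoid: expanding all generators to a common level N exhibits T_Λ as a direct limit of free
commutative monoids (`toT_eq_iff`). A leaf stays a single basis vector while any other vertex
eventually splits, so the atoms are the v(n) with v a leaf, and these are prime. Hence atomicity is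
`LeafBound` and aperiodicity of the atoms is `RigidLeaves`. A shift fixing a sum of atoms carries
its atoms around inside a finite multiset, so one of its positive powers fixes an atom; thus
aperiodic atoms force freeness.

Algebra: the elements s_α s_{β*} span. Under the two conditions they are sums of such elements with
s(β) a leaf, and then A s_{β*} is a minimal left ideal (`exists_mul_eq_P`). Conversely, a semisimple
ring satisfies the descending chain condition on idempotents below a given one, which forces
`LeafBound`, and it is von Neumann regular, which forces `RigidLeaves`: two paths γ, δ of different
degrees from one vertex to a leaf v would make P_v - s_γ s_{δ*} non-regular, as a representation on
germs of functions of the degree shows. -/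

namespace KGraph

variable {k : ℕ} {V : Type u} [Category.{w} V] (Λ : KGraph k V)

/-! ### Paths and unique factorization -/

@[simp] theorem degree_of {a b : V} (f : a ⟶ b) : Λ.degree (GPath.of f) = Λ.deg f := rfl

@[simp] theorem of_hom (p : GPath V) : GPath.of p.hom = p := rfl

@[simp] theorem of_inj {a b : V} {f g : a ⟶ b} : GPath.of f = GPath.of g ↔ f = g := by
  simp [GPath.of]

variable {Λ}

/-- Factorizations of a path are determined by the degree of the left factor. -/
theorem of_comp_inj {a b c a' b' c' : V} {g : c ⟶ b} {h : a ⟶ c} {g' : c' ⟶ b'} {h' : a' ⟶ c'}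
    (he : GPath.of (h ≫ g) = GPath.of (h' ≫ g')) (hd : Λ.deg g = Λ.deg g') :
    GPath.of g = GPath.of g' ∧ GPath.of h = GPath.of h' := by
  have h₁ : a = a' := congrArg GPath.src he
  have h₂ : b = b' := congrArg GPath.rng he
  subst h₁ h₂
  have he' : h ≫ g = h' ≫ g' := by simpa [GPath.of] using he
  have hdeg : Λ.deg h = Λ.deg h' := by
    have := congrArg Λ.deg he'
    rw [Λ.deg_comp, Λ.deg_comp, hd] at this
    exact add_left_cancel this
  have := (Λ.factorization (h ≫ g) (Λ.deg g) (Λ.deg h) (Λ.deg_comp h g)).unique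
    (y₁ := ⟨c, g, h⟩) (y₂ := ⟨c', g', h'⟩) ⟨rfl, rfl, rfl⟩ ⟨he'.symm, hd.symm, hdeg.symm⟩
  cases this
  exact ⟨rfl, rfl⟩

/-- A path of degree at least `m` has an initial segment of degree `m`. -/
theorem exists_factor (p : GPath V) {m n : Fin k → ℕ} (hp : Λ.degree p = m + n) :
    ∃ (c : V) (g : c ⟶ p.rng) (h : p.src ⟶ c),
      p = GPath.of (h ≫ g) ∧ Λ.deg g = m ∧ Λ.deg h = n := by
  obtain ⟨⟨c, g, h⟩, ⟨h1, h2, h3⟩, -⟩ := Λ.factorization p.hom m n hp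
  exact ⟨c, g, h, by simp only at h1; rw [h1]; rfl, h2, h3⟩

theorem mem_pathsTo {v : V} {n : Fin k → ℕ} {p : GPath V} :
    p ∈ Λ.pathsTo v n ↔ p.rng = v ∧ Λ.degree p = n := Iff.rfl

/-- Compare the two factorizations of p as p followed by an identity and as an identity followed by
p. -/
theorem pathsTo_zero (v : V) : Λ.pathsTo v 0 = {GPath.of (𝟙 v)} := by
  ext p
  constructor
  · rintro ⟨rfl, hp⟩
    have := (of_comp_inj (Λ := Λ) (g := p.hom) (h := 𝟙 _) (g' := 𝟙 p.rng) (h' := p.hom)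
      (by simp) (by rw [Λ.deg_id]; exact hp)).1
    simpa using this
  · rintro rfl
    exact ⟨rfl, Λ.deg_id v⟩

/-- Sums over the paths of degree `m + n` are iterated sums. -/
theorem finsum_pathsTo_add (hfin : Λ.RowFinite) {M : Type*} [AddCommMonoid M] (f : V → M) (v : V)
    (m n : Fin k → ℕ) :
    ∑ᶠ α ∈ Λ.pathsTo v (m + n), f α.src =
      ∑ᶠ α ∈ Λ.pathsTo v m, ∑ᶠ β ∈ Λ.pathsTo α.src n, f β.src := by
  have hU : Λ.pathsTo v (m + n) = ⋃ α ∈ Λ.pathsTo v m,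
      {p | Λ.degree p = m + n ∧ Extends p α} := by
    ext p
    simp only [Set.mem_iUnion, Set.mem_ofPred_eq, exists_prop]
    constructor
    · rintro ⟨rfl, hp⟩
      obtain ⟨c, g, h, h1, h2, h3⟩ := exists_factor p hp
      exact ⟨GPath.of g, ⟨rfl, h2⟩, hp, p.src, h, h1⟩
    · rintro ⟨α, ⟨rfl, hα⟩, hp, c, q, rfl⟩
      exact ⟨rfl, hp⟩
  rw [hU, finsum_mem_biUnion]
  · refine finsum_mem_congr rfl fun α hα => ?_
    symm
    classical
    -- The bijection is β ↦ αβ; the else branch is a junk value, never reached on the index set.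
    refine finsum_mem_eq_of_bijOn
      (fun β => if h : β.rng = α.src then GPath.of (β.hom ≫ eqToHom h ≫ α.hom) else β)
      ⟨?_, ?_, ?_⟩ ?_
    · rintro ⟨a, b, β⟩ ⟨rfl, hβ⟩
      simp only [dite_true, eqToHom_refl, Category.id_comp, Set.mem_ofPred_eq, degree_of,
        Λ.deg_comp]
      exact ⟨congrArg₂ _ hα.2 hβ, a, β, rfl⟩
    · rintro ⟨a, b, β⟩ ⟨rfl, hβ⟩ ⟨a', b', β'⟩ ⟨hb, hβ'⟩ he
      simp only at hb
      subst hb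
      change (if h : _ then GPath.of (β ≫ eqToHom h ≫ α.hom) else _) =
        (if h : _ then GPath.of (β' ≫ eqToHom h ≫ α.hom) else _) at he
      rw [dif_pos rfl, dif_pos rfl, eqToHom_refl, Category.id_comp] at he
      exact (of_comp_inj (Λ := Λ) he rfl).2
    · rintro p ⟨hp, c, q, rfl⟩
      refine ⟨GPath.of q, ⟨rfl, ?_⟩, ?_⟩
      · rw [degree_of, Λ.deg_comp] at hp
        rw [← hα.2] at hp
        exact add_left_cancel hp
      · change (if h : _ then GPath.of (q ≫ eqToHom h ≫ α.hom) else _) = _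
        rw [dif_pos rfl, eqToHom_refl, Category.id_comp]
    · rintro ⟨a, b, β⟩ ⟨rfl, hβ⟩
      simp [GPath.of]
  · rintro α hα β hβ hne
    refine Set.disjoint_left.2 ?_
    rintro p ⟨-, c, q, rfl⟩ ⟨-, c', q', he⟩
    exact hne (of_comp_inj (Λ := Λ) he (hα.2.trans hβ.2.symm)).1
  · exact hfin v m
  · intro α hα
    refine (hfin v (m + n)).subset ?_
    rintro p ⟨hp, c, q, rfl⟩
    exact ⟨hα.1, hp⟩

/-! ### Leaves -/

theorem existsUnique_of_mem_leaves {v : V} (hv : v ∈ Λ.leaves) (n : Fin k → ℕ) :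
    ∃! p, p ∈ Λ.pathsTo v n := by
  obtain ⟨p, hp⟩ := Set.ncard_eq_one.1 (hv n)
  exact ⟨p, by simp [hp], fun q hq => by simpa [hp] using hq⟩

theorem eq_of_mem_leaves {p q : GPath V} (hv : p.rng ∈ Λ.leaves) (h : p.rng = q.rng)
    (hd : Λ.degree p = Λ.degree q) : p = q :=
  (existsUnique_of_mem_leaves hv _).unique ⟨rfl, rfl⟩ ⟨h.symm, hd.symm⟩

theorem mem_leaves_of_unique (hsrc : Λ.NoSources) {v : V}
    (h : ∀ p q : GPath V, p.rng = v → q.rng = v → Λ.degree p = Λ.degree q → p = q) :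
    v ∈ Λ.leaves := by
  intro m
  obtain ⟨p, hp⟩ := hsrc v m
  refine Set.ncard_eq_one.2 ⟨p, Set.eq_singleton_iff_unique_mem.2 ⟨hp, fun q hq => ?_⟩⟩
  exact h q p hq.1 hp.1 (hq.2.trans hp.2.symm)

/-- Composing with p turns two paths of equal degree into s(p) into two such paths into the leaf
r(p); these agree, and p cancels. -/
theorem src_mem_leaves (hsrc : Λ.NoSources) {p : GPath V} (hp : p.rng ∈ Λ.leaves) :
    p.src ∈ Λ.leaves := by
  refine mem_leaves_of_unique hsrc ?_
  rintro ⟨a, b, f⟩ ⟨a', b', g⟩ (rfl : b = _) (rfl : b' = _) hd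
  have := eq_of_mem_leaves (Λ := Λ) (p := GPath.of (f ≫ p.hom)) (q := GPath.of (g ≫ p.hom)) hp rfl
    (by rw [degree_of, degree_of, Λ.deg_comp, Λ.deg_comp]; exact congrArg _ hd)
  exact (of_comp_inj (Λ := Λ) this rfl).2

/-- Every vertex eventually emits to leaves only. -/
def LeafBound (Λ : KGraph k V) : Prop :=
  ∀ v : V, ∃ n : Fin k → ℕ, ∀ p ∈ Λ.pathsTo v n, p.src ∈ Λ.leaves

/-- Two paths into a leaf with the same source are equal. -/
def RigidLeaves (Λ : KGraph k V) : Prop :=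
  ∀ p q : GPath V, p.rng ∈ Λ.leaves → p.rng = q.rng → p.src = q.src → p = q

theorem src_mem_leaves_of_le (hsrc : Λ.NoSources) {v : V} {m n : Fin k → ℕ} (hmn : m ≤ n)
    (h : ∀ p ∈ Λ.pathsTo v m, p.src ∈ Λ.leaves) : ∀ p ∈ Λ.pathsTo v n, p.src ∈ Λ.leaves := by
  rintro p ⟨rfl, hp⟩
  obtain ⟨c, g, q, he, hg, hq⟩ := exists_factor (Λ := Λ) p (m := m) (n := n - m)
    (by rw [hp, add_tsub_cancel_of_le hmn])
  exact src_mem_leaves (p := GPath.of q) hsrc (h (GPath.of g) ⟨rfl, hg⟩)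

/-- There are finitely many paths in vΛⁿ, so the bounds at their sources have a common upper bound
M, and n + M works for v. -/
theorem saturated_of_leafBound (hfin : Λ.RowFinite) (hsrc : Λ.NoSources) :
    Λ.Saturated {v | ∃ n : Fin k → ℕ, ∀ p ∈ Λ.pathsTo v n, p.src ∈ Λ.leaves} := by
  intro v n h
  have h' : ∀ p ∈ Λ.pathsTo v n, ∃ m : Fin k → ℕ, ∀ q ∈ Λ.pathsTo p.src m, q.src ∈ Λ.leaves :=
    fun p hp => h ⟨p, hp, rfl⟩
  choose! m hm using h'
  obtain ⟨M, hM⟩ := ((hfin v n).image m).bddAbove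
  refine ⟨n + M, ?_⟩
  rintro p ⟨rfl, hp⟩
  obtain ⟨c, g, q, he, hg, hq⟩ := exists_factor (Λ := Λ) p hp
  have hg' : GPath.of g ∈ Λ.pathsTo p.rng n := ⟨rfl, hg⟩
  exact src_mem_leaves_of_le hsrc (hM ⟨_, hg', rfl⟩) (hm _ hg') (GPath.of q) ⟨rfl, hq⟩

theorem hsClosure_leaves_eq_univ_iff (hfin : Λ.RowFinite) (hsrc : Λ.NoSources) :
    Λ.hsClosure Λ.leaves = Set.univ ↔ Λ.LeafBound := by
  constructor
  · intro h v
    have hv : v ∈ Λ.hsClosure Λ.leaves := h ▸ Set.mem_univ v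
    refine hv {v | ∃ n : Fin k → ℕ, ∀ p ∈ Λ.pathsTo v n, p.src ∈ Λ.leaves}
      ⟨?_, saturated_of_leafBound hfin hsrc, ?_⟩
    · rintro p ⟨n, hn⟩
      refine ⟨n, ?_⟩
      rintro ⟨a, b, q⟩ ⟨rfl, hq⟩
      -- A path q of degree n into s(p) is tested on pq, whose degree d(p) + n still exceeds the
      -- bound n for r(p).
      refine src_mem_leaves_of_le hsrc (n := Λ.degree p + n) le_add_self hn
        (GPath.of (q ≫ p.hom)) ⟨rfl, ?_⟩
      rw [degree_of, Λ.deg_comp]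
      exact congrArg _ hq
    · intro v hv
      refine ⟨0, fun p hp => ?_⟩
      rw [pathsTo_zero] at hp
      subst hp
      exact hv
  · intro h
    refine Set.eq_univ_of_forall fun v H hH => ?_
    obtain ⟨n, hn⟩ := h v
    refine hH.2.1 v n ?_
    rintro _ ⟨p, hp, rfl⟩
    exact hH.2.2 (hn p hp)

/-- A leaf receives exactly one path in each degree, so any two paths into it have a minimal common
extension and no τ can separate them. -/
theorem rigidLeaves_of_aperiodic (hsrc : Λ.NoSources) (h : Λ.Aperiodic) : Λ.RigidLeaves := by
  rintro ⟨a, b, α⟩ ⟨a', b', β⟩ hv (rfl : b = b') (rfl : a = a')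
  by_contra hne
  obtain ⟨e, τ, hτ⟩ := h a b b α β hne
  obtain ⟨t, ht, ht'⟩ := hsrc b (Λ.deg (τ ≫ α) ⊔ Λ.deg (τ ≫ β))
  subst ht
  have key (f : e ⟶ t.rng) (hf : Λ.deg f ≤ Λ.degree t) : Extends t (GPath.of f) := by
    obtain ⟨c, g, q, he, hg, hq⟩ := exists_factor (Λ := Λ) t (add_tsub_cancel_of_le hf).symm
    have := eq_of_mem_leaves (Λ := Λ) (p := GPath.of g) (q := GPath.of f) hv rfl hg
    obtain rfl : c = e := congrArg GPath.src this
    obtain rfl : g = f := of_inj.1 this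
    exact ⟨_, q, he⟩
  have : t ∈ Λ.MCE (GPath.of (τ ≫ α)) (GPath.of (τ ≫ β)) :=
    ⟨ht', key _ (by rw [ht']; exact le_sup_left), key _ (by rw [ht']; exact le_sup_right)⟩
  simp [hτ] at this

/-- Take τ with a leaf as source. If ατμ = βτν, rigidity gives μ = ν, so d(α) = d(β), and unique
factorization gives α = β. -/
theorem aperiodic_of_rigidLeaves (hsrc : Λ.NoSources) (hL : Λ.LeafBound) (hR : Λ.RigidLeaves) :
    Λ.Aperiodic := by
  intro a b c α β hne
  obtain ⟨n, hn⟩ := hL a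
  obtain ⟨⟨e, a', τ⟩, hτ⟩ := hsrc a n
  obtain rfl : a' = a := hτ.1
  refine ⟨e, τ, Set.eq_empty_of_forall_notMem ?_⟩
  rintro t ⟨-, ⟨d, (μ : d ⟶ e), rfl⟩, ⟨d', (ν : d' ⟶ e), he⟩⟩
  change GPath.of (μ ≫ τ ≫ α) = GPath.of (ν ≫ τ ≫ β) at he
  obtain rfl : d = d' := congrArg GPath.src he
  have he₀ : e ∈ Λ.leaves := hn _ hτ
  obtain rfl : μ = ν := of_inj.1 (hR (GPath.of μ) (GPath.of ν) he₀ rfl rfl)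
  refine hne ?_
  rw [← Category.assoc, ← Category.assoc] at he
  refine (of_comp_inj (Λ := Λ) he ?_).1
  have := congrArg Λ.degree he
  rw [degree_of, degree_of, Λ.deg_comp, Λ.deg_comp (μ ≫ τ) β] at this
  exact add_right_cancel this

theorem hsClosure_aperiodic_iff (hfin : Λ.RowFinite) (hsrc : Λ.NoSources) :
    (Λ.hsClosure Λ.leaves = Set.univ ∧ Λ.Aperiodic) ↔ Λ.LeafBound ∧ Λ.RigidLeaves := by
  rw [hsClosure_leaves_eq_univ_iff hfin hsrc]
  exact ⟨fun h => ⟨h.1, rigidLeaves_of_aperiodic hsrc h.2⟩,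
    fun h => ⟨h.1, aperiodic_of_rigidLeaves hsrc h.1 h.2⟩⟩

end KGraph

/-! ### The talented monoid as a direct limit of free monoids -/

namespace KGraph

open Filter

variable {k : ℕ} {V : Type u} [Category.{w} V] (Λ : KGraph k V)

/-- The generator `v(n)` of the talented monoid. -/
noncomputable def vt (v : V) (n : Fin k → ℤ) : Λ.TMonoid := Λ.toT (Λ.gen v n)

/-- The inclusion of `ℕ^k` into `ℤ^k`. -/
noncomputable def natVec : (Fin k → ℕ) →+ (Fin k → ℤ) := (Nat.castAddMonoidHom ℤ).compLeft (Fin k)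

theorem natVec_apply (m : Fin k → ℕ) (i : Fin k) : natVec m i = (m i : ℤ) := rfl

theorem natVec_injective : Function.Injective (natVec (k := k)) := fun m n h => by
  funext i
  have := congrFun h i
  simpa [natVec_apply] using this

theorem natVec_single (i : Fin k) : natVec (Pi.single i 1) = Pi.single i 1 := by
  funext j
  rw [natVec_apply]
  by_cases h : j = i
  · subst h; simp
  · simp [h]

theorem exists_natVec {n N : Fin k → ℤ} (h : n ≤ N) : ∃ m : Fin k → ℕ, N = n + natVec m := by
  refine ⟨fun i => (N i - n i).toNat, ?_⟩
  funext i
  have : n i ≤ N i := h i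
  simp only [Pi.add_apply, natVec_apply]
  omega

theorem eventually_natVec (n : Fin k → ℤ) :
    ∀ᶠ N in atTop, ∃ m : Fin k → ℕ, N = n + natVec m :=
  (eventually_ge_atTop n).mono fun _ => exists_natVec

/-- Replace each `v(n)`, where `n ≤ N`, by the sum of the sources of the paths in `vΛ^(N - n)`. -/
noncomputable def push (N : Fin k → ℤ) : Λ.FreeT →+ (V →₀ ℕ) :=
  Finsupp.liftAddHom fun x => multiplesHom _
    -- The truncation by `toNat` makes this meaningless unless x.2 ≤ N; hence the statements below
    -- hold only eventually in N.
    (∑ᶠ α ∈ Λ.pathsTo x.1 (fun i => (N i - x.2 i).toNat), Finsupp.single α.src 1)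

/-- The homomorphism that sends `v` to `v(N)`. -/
noncomputable def emb (N : Fin k → ℤ) : (V →₀ ℕ) →+ Λ.TMonoid :=
  Finsupp.liftAddHom fun v => multiplesHom _ (Λ.vt v N)

@[simp] theorem emb_single (N : Fin k → ℤ) (v : V) : Λ.emb N (Finsupp.single v 1) = Λ.vt v N := by
  simp [emb]

theorem push_gen (n : Fin k → ℤ) (m : Fin k → ℕ) (v : V) :
    Λ.push (n + natVec m) (Λ.gen v n) = ∑ᶠ α ∈ Λ.pathsTo v m, Finsupp.single α.src 1 := by
  have : (fun i => ((n + natVec m) i - n i).toNat) = m := by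
    funext i
    simp [natVec_apply]
  rw [push, gen, Finsupp.liftAddHom_apply_single, this, multiplesHom_apply, one_nsmul]

theorem freeT_induction {P : Λ.FreeT → Prop} (h0 : P 0) (hadd : ∀ x y, P x → P y → P (x + y))
    (hgen : ∀ v n, P (Λ.gen v n)) (x : Λ.FreeT) : P x := by
  induction x using Finsupp.induction_linear with
  | zero => exact h0
  | add x y hx hy => exact hadd x y hx hy
  | single a c =>
    induction c with
    | zero => simpa using h0
    | succ c ih =>
      rw [Finsupp.single_add]
      exact hadd _ _ ih (hgen a.1 a.2)

variable {Λ}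

theorem exists_toT (a : Λ.TMonoid) : ∃ x, Λ.toT x = a := Quotient.exists_rep a

theorem tMonoid_induction {P : Λ.TMonoid → Prop} (h0 : P 0)
    (hadd : ∀ x y, P x → P y → P (x + y)) (hgen : ∀ v n, P (Λ.vt v n)) (a : Λ.TMonoid) : P a := by
  obtain ⟨x, rfl⟩ := exists_toT a
  refine Λ.freeT_induction (P := fun x => P (Λ.toT x)) ?_ (fun x y hx hy => ?_) hgen x
  · rwa [map_zero]
  · rw [map_add]
    exact hadd _ _ hx hy

theorem smul_vt (m : Multiplicative (Fin k → ℤ)) (v : V) (n : Fin k → ℤ) :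
    m • Λ.vt v n = Λ.vt v (m.toAdd + n) := by
  change Λ.shift m.toAdd (Λ.toT (Λ.gen v n)) = _
  rw [shift_toT, freeShift_gen, vt]

/-- Induction on the total degree of m: split off one e_i and apply a defining relation at each
source. -/
theorem vt_eq_sum (hfin : Λ.RowFinite) (hsrc : Λ.NoSources) (v : V) (n : Fin k → ℤ)
    (m : Fin k → ℕ) : Λ.vt v n = ∑ᶠ α ∈ Λ.pathsTo v m, Λ.vt α.src (n + natVec m) := by
  induction hs : ∑ i, m i generalizing m with
  | zero =>
    obtain rfl : m = 0 := by
      funext i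
      simpa using (Finset.sum_eq_zero_iff.1 hs) i (Finset.mem_univ i)
    rw [pathsTo_zero, finsum_mem_singleton, map_zero, add_zero]
    rfl
  | succ s ih =>
    obtain ⟨i, hi⟩ : ∃ i, m i ≠ 0 := by
      by_contra! h
      simp [h] at hs
    obtain ⟨e, he⟩ : ∃ e : Fin k → ℕ, e = Pi.single i 1 := ⟨_, rfl⟩
    obtain ⟨m', rfl⟩ : ∃ m' : Fin k → ℕ, m = m' + e := by
      refine ⟨m - e, (tsub_add_cancel_of_le ?_).symm⟩
      rw [he]
      intro j
      by_cases h : j = i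
      · subst h; simpa using Nat.one_le_iff_ne_zero.2 hi
      · simp [h]
    have hs' : ∑ i, m' i = s := by
      simpa [he, Finset.sum_add_distrib] using hs
    -- All summands lie at the same level z, so they depend only on the source, as
    -- `finsum_pathsTo_add` requires.
    obtain ⟨z, hz⟩ : ∃ z : Fin k → ℤ, z = n + natVec (m' + e) := ⟨_, rfl⟩
    rw [ih m' hs', ← hz, finsum_pathsTo_add hfin (fun w => Λ.vt w z) v m' e]
    refine finsum_mem_congr rfl fun α _ => ?_
    rw [hz, natVec.map_add, he, natVec_single, ← add_assoc]
    have := Λ.toT_rel (TRel.mk α.src (n + natVec m') i (hsrc _ _))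
    exact this.trans (Λ.toT.map_finsum_mem _ (hfin _ _))

/-- Once N ≥ n + e_i, a path of degree N - n factors through its initial segment of degree e_i. -/
theorem eventually_push_gen_eq (hfin : Λ.RowFinite) (v : V) (n : Fin k → ℤ) (i : Fin k) :
    ∀ᶠ N in atTop, Λ.push N (Λ.gen v n) =
      Λ.push N (∑ᶠ α ∈ Λ.pathsTo v (Pi.single i 1), Λ.gen α.src (n + Pi.single i 1)) := by
  filter_upwards [eventually_natVec (n + Pi.single i 1)] with N ⟨m, hm⟩
  rw [AddMonoidHom.map_finsum_mem _ _ (hfin _ _)]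
  have h1 : N = n + natVec (Pi.single i 1 + m) := by
    rw [hm, map_add, natVec_single, add_assoc]
  conv_lhs => rw [h1, push_gen, finsum_pathsTo_add hfin (fun v => Finsupp.single v 1)]
  refine finsum_mem_congr rfl fun α _ => ?_
  rw [hm, push_gen]

theorem eventually_emb_push (hfin : Λ.RowFinite) (hsrc : Λ.NoSources) (x : Λ.FreeT) :
    ∀ᶠ N in atTop, Λ.emb N (Λ.push N x) = Λ.toT x := by
  refine Λ.freeT_induction (P := fun x => ∀ᶠ N in atTop, Λ.emb N (Λ.push N x) = Λ.toT x)
    ?_ (fun x y hx hy => ?_) (fun v n => ?_) x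
  · simp
  · filter_upwards [hx, hy] with N h1 h2
    rw [map_add, map_add, map_add, h1, h2]
  · filter_upwards [eventually_natVec n] with N ⟨m, hm⟩
    rw [hm, push_gen, AddMonoidHom.map_finsum_mem _ _ (hfin _ _)]
    simp only [emb_single]
    exact (vt_eq_sum hfin hsrc v n m).symm

/-- Two elements of the free commutative monoid agree in the talented monoid if and only if they
agree after all the vertices are expanded far enough. -/
theorem toT_eq_iff (hfin : Λ.RowFinite) (hsrc : Λ.NoSources) {x y : Λ.FreeT} :
    Λ.toT x = Λ.toT y ↔ ∀ᶠ N in atTop, Λ.push N x = Λ.push N y := by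
  constructor
  · intro h
    -- Eventual equality of the expansions is itself a congruence containing the defining relations.
    let c : AddCon Λ.FreeT :=
      { r := fun x y => ∀ᶠ N in atTop, Λ.push N x = Λ.push N y
        iseqv := ⟨fun _ => .of_forall fun _ => rfl, fun h => h.mono fun _ => Eq.symm,
          fun h h' => by filter_upwards [h, h'] with N h1 h2 using h1.trans h2⟩
        add' := fun h h' => by
          filter_upwards [h, h'] with N h1 h2
          rw [map_add, map_add, h1, h2] }
    have hc : addConGen Λ.TRel ≤ c := by
      refine AddCon.addConGen_le.2 ?_
      rintro _ _ ⟨v, n, i, -⟩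
      exact eventually_push_gen_eq hfin v n i
    exact hc ((AddCon.eq _).1 h)
  · intro h
    obtain ⟨N, h1, h2, h3⟩ := (h.and ((eventually_emb_push hfin hsrc x).and
      (eventually_emb_push hfin hsrc y))).exists
    rw [← h2, h1, h3]

theorem eventually_push_gen_ne_zero (hfin : Λ.RowFinite) (hsrc : Λ.NoSources) (v : V)
    (n : Fin k → ℤ) : ∀ᶠ N in atTop, Λ.push N (Λ.gen v n) ≠ 0 := by
  filter_upwards [eventually_natVec n] with N ⟨m, hm⟩ h
  rw [hm, push_gen, finsum_mem_eq_finite_toFinset_sum _ (hfin v m)] at h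
  obtain ⟨p, hp⟩ := hsrc v m
  have := Finset.sum_eq_zero_iff.1 h p (by simpa using hp)
  simp at this

theorem vt_ne_zero (hfin : Λ.RowFinite) (hsrc : Λ.NoSources) (v : V) (n : Fin k → ℤ) :
    Λ.vt v n ≠ 0 := by
  intro h
  have := (toT_eq_iff hfin hsrc (y := 0)).1 (h.trans (map_zero Λ.toT).symm)
  obtain ⟨N, h1, h2⟩ := (this.and (eventually_push_gen_ne_zero hfin hsrc v n)).exists
  exact h2 (by rw [h1, map_zero])

/-- Inherited from the free monoid at each large level: a sum of vectors over ℕ vanishes only if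
both do. -/
theorem eq_zero_of_add_eq_zero (hfin : Λ.RowFinite) (hsrc : Λ.NoSources) {a b : Λ.TMonoid}
    (h : a + b = 0) : a = 0 := by
  obtain ⟨x, rfl⟩ := exists_toT a
  obtain ⟨y, rfl⟩ := exists_toT b
  rw [← map_add, ← map_zero Λ.toT, toT_eq_iff hfin hsrc] at h
  rw [← map_zero Λ.toT, toT_eq_iff hfin hsrc]
  filter_upwards [h] with N hN
  rw [map_add, map_zero] at hN
  rw [(add_eq_zero.1 hN).1, map_zero]

theorem isAddUnit_iff (hfin : Λ.RowFinite) (hsrc : Λ.NoSources) {a : Λ.TMonoid} :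
    IsAddUnit a ↔ a = 0 := by
  constructor
  · rintro ⟨u, rfl⟩
    exact eq_zero_of_add_eq_zero hfin hsrc u.add_neg
  · rintro rfl
    exact isAddUnit_zero

/-! ### Atoms of the talented monoid -/

theorem vt_eq_of_mem_leaves (hfin : Λ.RowFinite) (hsrc : Λ.NoSources) {p : GPath V}
    (hp : p.rng ∈ Λ.leaves) (n : Fin k → ℤ) :
    Λ.vt p.rng n = Λ.vt p.src (n + natVec (Λ.degree p)) := by
  have : Λ.pathsTo p.rng (Λ.degree p) = {p} :=
    Set.eq_singleton_iff_unique_mem.2 ⟨⟨rfl, rfl⟩, fun q hq =>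
      (existsUnique_of_mem_leaves hp _).unique hq ⟨rfl, rfl⟩⟩
  rw [vt_eq_sum hfin hsrc p.rng n (Λ.degree p), this, finsum_mem_singleton]

theorem push_gen_of_mem_leaves {p : GPath V} (hp : p.rng ∈ Λ.leaves) (n : Fin k → ℤ) :
    Λ.push (n + natVec (Λ.degree p)) (Λ.gen p.rng n) = Finsupp.single p.src 1 := by
  have : Λ.pathsTo p.rng (Λ.degree p) = {p} :=
    Set.eq_singleton_iff_unique_mem.2 ⟨⟨rfl, rfl⟩, fun q hq =>
      (existsUnique_of_mem_leaves hp _).unique hq ⟨rfl, rfl⟩⟩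
  rw [push_gen, this, finsum_mem_singleton]

/-- A vertex that is a leaf gives a prime element of the talented monoid. -/
theorem exists_eq_vt_add (hfin : Λ.RowFinite) (hsrc : Λ.NoSources) {v : V} (hv : v ∈ Λ.leaves)
    {n : Fin k → ℤ} {a b c : Λ.TMonoid} (h : Λ.vt v n + c = a + b) :
    (∃ d, a = Λ.vt v n + d) ∨ ∃ d, b = Λ.vt v n + d := by
  obtain ⟨x, rfl⟩ := exists_toT a
  obtain ⟨y, rfl⟩ := exists_toT b
  obtain ⟨z, rfl⟩ := exists_toT c
  rw [vt, ← map_add, ← map_add, toT_eq_iff hfin hsrc] at h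
  obtain ⟨N, h, hx, hy, m, hm⟩ := (h.and ((eventually_emb_push hfin hsrc x).and
    ((eventually_emb_push hfin hsrc y).and (eventually_natVec n)))).exists
  obtain ⟨p, rfl, rfl⟩ := (existsUnique_of_mem_leaves hv m).exists
  subst hm
  rw [map_add, map_add, push_gen_of_mem_leaves hv] at h
  have key : ∀ g : V →₀ ℕ, g p.src ≠ 0 →
      ∃ d, Λ.emb (n + natVec (Λ.degree p)) g = Λ.vt p.rng n + d := by
    intro g hg
    have hle : Finsupp.single p.src 1 ≤ g := by
      rw [Finsupp.single_le_iff]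
      omega
    obtain ⟨g', rfl⟩ := exists_add_of_le hle
    exact ⟨_, by rw [map_add, emb_single, vt_eq_of_mem_leaves hfin hsrc hv]⟩
  rw [← hx, ← hy]
  -- At this level v(n) is the basis vector of s(p), so the coordinate there is positive in one of
  -- the two summands.
  have hs := DFunLike.congr_fun h p.src
  simp only [Finsupp.add_apply, Finsupp.single_eq_same] at hs
  by_cases h0 : Λ.push (n + natVec (Λ.degree p)) x p.src = 0
  · exact .inr (key _ (by omega))
  · exact .inl (key _ h0)

/-- Expanded to a high level, v(n) has coordinate sum 1, so one of two summands has coordinate sum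
0. -/
theorem addIrreducible_vt (hfin : Λ.RowFinite) (hsrc : Λ.NoSources) {v : V} (hv : v ∈ Λ.leaves)
    (n : Fin k → ℤ) : AddIrreducible (Λ.vt v n) := by
  refine ⟨fun h => vt_ne_zero hfin hsrc v n ((isAddUnit_iff hfin hsrc).1 h), ?_⟩
  intro a b h
  obtain ⟨x, rfl⟩ := exists_toT a
  obtain ⟨y, rfl⟩ := exists_toT b
  simp only [isAddUnit_iff hfin hsrc]
  rw [vt, ← map_add, toT_eq_iff hfin hsrc] at h
  obtain ⟨N, h, hx, hy, m, hm⟩ := (h.and ((eventually_emb_push hfin hsrc x).and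
    ((eventually_emb_push hfin hsrc y).and (eventually_natVec n)))).exists
  obtain ⟨p, rfl, rfl⟩ := (existsUnique_of_mem_leaves hv m).exists
  subst hm
  rw [map_add, push_gen_of_mem_leaves hv] at h
  rw [← hx, ← hy]
  have hs := congrArg Finsupp.degree h
  rw [Finsupp.degree_single, map_add] at hs
  rcases (Nat.add_eq_one_iff.1 hs.symm) with h | h
  · exact .inl (by rw [(Finsupp.degree_eq_zero_iff _).1 h.1, map_zero])
  · exact .inr (by rw [(Finsupp.degree_eq_zero_iff _).1 h.2, map_zero])

/-- Two different paths of the same degree into v give two nonzero summands in the expansion of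
v(n). -/
theorem mem_leaves_of_addIrreducible (hfin : Λ.RowFinite) (hsrc : Λ.NoSources) {v : V}
    {n : Fin k → ℤ} (h : AddIrreducible (Λ.vt v n)) : v ∈ Λ.leaves := by
  classical
  refine mem_leaves_of_unique hsrc ?_
  rintro p q rfl hq hd
  by_contra hne
  have h1 := vt_eq_sum hfin hsrc p.rng n (Λ.degree p)
  rw [finsum_mem_eq_finite_toFinset_sum _ (hfin _ _),
    ← Finset.add_sum_erase _ _ (show p ∈ _ by simp [mem_pathsTo])] at h1
  rcases h.2 h1 with h2 | h2
  · exact vt_ne_zero hfin hsrc _ _ ((isAddUnit_iff hfin hsrc).1 h2)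
  · rw [isAddUnit_iff hfin hsrc, ← Finset.add_sum_erase (a := q) _ _
      (by simp [mem_pathsTo, hq, hd, Ne.symm hne])] at h2
    exact vt_ne_zero hfin hsrc _ _ (eq_zero_of_add_eq_zero hfin hsrc h2)

/-- The atoms of the talented monoid are the elements `v(n)` with a leaf `v`. -/
theorem addIrreducible_iff (hfin : Λ.RowFinite) (hsrc : Λ.NoSources) {a : Λ.TMonoid} :
    AddIrreducible a ↔ ∃ v ∈ Λ.leaves, ∃ n, a = Λ.vt v n := by
  constructor
  · intro h
    obtain ⟨x, rfl⟩ := exists_toT a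
    obtain ⟨N, hN⟩ := (eventually_emb_push hfin hsrc x).exists
    have hg : Λ.push N x ≠ 0 := by
      intro h0
      rw [h0, map_zero] at hN
      exact h.1 ((isAddUnit_iff hfin hsrc).2 hN.symm)
    -- Any vertex v in the expansion splits off a summand v(N), which must be the whole of the atom.
    obtain ⟨v, hv⟩ := Finsupp.ne_iff.1 hg
    have hle : Finsupp.single v 1 ≤ Λ.push N x := by
      rw [Finsupp.single_le_iff]
      exact Nat.one_le_iff_ne_zero.2 hv
    obtain ⟨g, hg⟩ := exists_add_of_le hle
    rw [hg, map_add, emb_single] at hN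
    have hxv : Λ.toT x = Λ.vt v N := by
      rcases h.2 hN.symm with h1 | h1
      · exact absurd ((isAddUnit_iff hfin hsrc).1 h1) (vt_ne_zero hfin hsrc v N)
      · rw [← hN, (isAddUnit_iff hfin hsrc).1 h1, add_zero]
    rw [hxv] at h
    exact ⟨v, mem_leaves_of_addIrreducible hfin hsrc h, N, hxv⟩
  · rintro ⟨v, hv, n, rfl⟩
    exact addIrreducible_vt hfin hsrc hv n

theorem eventually_support_push_subset_leaves (hfin : Λ.RowFinite) (hsrc : Λ.NoSources)
    (s : Multiset Λ.TMonoid) (hs : ∀ b ∈ s, AddIrreducible b) :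
    ∃ x, Λ.toT x = s.sum ∧ ∀ᶠ N in atTop, ∀ v, Λ.push N x v ≠ 0 → v ∈ Λ.leaves := by
  induction s using Multiset.induction with
  | empty => exact ⟨0, by simp, by simp⟩
  | cons a s ih =>
    obtain ⟨x, hx, hx'⟩ := ih fun b hb => hs b (Multiset.mem_cons_of_mem hb)
    obtain ⟨v, hv, n, rfl⟩ := (addIrreducible_iff hfin hsrc).1 (hs a (Multiset.mem_cons_self _ _))
    refine ⟨Λ.gen v n + x, by rw [map_add, Multiset.sum_cons, hx]; rfl, ?_⟩
    filter_upwards [hx', eventually_natVec n] with N hN ⟨m, hm⟩ w hw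
    obtain ⟨p, rfl, rfl⟩ := (existsUnique_of_mem_leaves hv m).exists
    rw [hm, map_add, push_gen_of_mem_leaves hv, ← hm, Finsupp.add_apply] at hw
    by_cases hpw : p.src = w
    · exact hpw ▸ src_mem_leaves hsrc hv
    · rw [Finsupp.single_eq_of_ne (Ne.symm hpw), zero_add] at hw
      exact hN w hw

/-- If v(0) is a sum of atoms, its expansion to a high level involves leaves only, and that
expansion lists the sources of the paths in vΛᵐ. Conversely, expanding v(n) by the bound at v writes
it as a sum of atoms. -/
theorem isAtomicMonoid_iff (hfin : Λ.RowFinite) (hsrc : Λ.NoSources) :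
    IsAtomicMonoid Λ.TMonoid ↔ Λ.LeafBound := by
  constructor
  · intro h v
    obtain ⟨s, hs, hsum⟩ := h (Λ.vt v 0)
      (fun hu => vt_ne_zero hfin hsrc v 0 ((isAddUnit_iff hfin hsrc).1 hu))
    obtain ⟨x, hx, hx'⟩ := eventually_support_push_subset_leaves hfin hsrc s hs
    have he := (toT_eq_iff hfin hsrc).1 (hx.trans hsum)
    obtain ⟨N, h1, h2, m, hm⟩ := (hx'.and (he.and (eventually_natVec 0))).exists
    refine ⟨m, fun p hp => h1 _ ?_⟩
    rw [h2, hm, push_gen, finsum_mem_eq_finite_toFinset_sum _ (hfin v m), Finsupp.finsetSum_apply]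
    intro h0
    have := Finset.sum_eq_zero_iff.1 h0 p (by simpa using hp)
    simp at this
  · intro h a _
    refine tMonoid_induction (P := fun a => ∃ s : Multiset Λ.TMonoid,
      (∀ b ∈ s, AddIrreducible b) ∧ s.sum = a) ⟨0, by simp, by simp⟩ ?_ ?_ a
    · rintro x y ⟨s, hs, rfl⟩ ⟨t, ht, rfl⟩
      refine ⟨s + t, fun b hb => ?_, Multiset.sum_add s t⟩
      exact (Multiset.mem_add.1 hb).elim (hs b) (ht b)
    · intro v n
      obtain ⟨m, hm⟩ := h v
      refine ⟨(hfin v m).toFinset.val.map fun α => Λ.vt α.src (n + natVec m), ?_, ?_⟩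
      · intro b hb
        obtain ⟨α, hα, rfl⟩ := Multiset.mem_map.1 hb
        exact addIrreducible_vt hfin hsrc (hm α (by simpa using hα)) _
      · rw [vt_eq_sum hfin hsrc v n m, finsum_mem_eq_finite_toFinset_sum _ (hfin v m)]
        rfl

/-- Paths p, q from u to a leaf v give v(0) = u(d(p)) = u(d(q)), so the shift by d(q) - d(p) fixes
v(0). Conversely, a shift fixing v(n) yields two paths from one source to v whose degrees differ by
that shift. -/
theorem atoms_aperiodic_iff (hfin : Λ.RowFinite) (hsrc : Λ.NoSources) :
    (∀ a : Λ.TMonoid, AddIrreducible a → IsAperiodicElt (Multiplicative (Fin k → ℤ)) a) ↔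
      Λ.RigidLeaves := by
  constructor
  · intro h p q hp hpq hs
    refine eq_of_mem_leaves hp hpq ?_
    by_contra hne
    refine (h (Λ.vt p.rng 0) (addIrreducible_vt hfin hsrc hp 0)).2
      ⟨vt_ne_zero hfin hsrc _ _, Multiplicative.ofAdd (natVec (Λ.degree q) - natVec (Λ.degree p)),
        ?_, ?_⟩
    · rw [Ne, ofAdd_eq_one, sub_eq_zero]
      exact fun h => hne (natVec_injective h).symm
    · rw [smul_vt, toAdd_ofAdd, vt_eq_of_mem_leaves hfin hsrc hp, hs, hpq,
        vt_eq_of_mem_leaves hfin hsrc (hpq ▸ hp)]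
      congr 1
      abel
  · intro h a ha
    obtain ⟨v, hv, n, rfl⟩ := (addIrreducible_iff hfin hsrc).1 ha
    refine ⟨vt_ne_zero hfin hsrc v n, ?_⟩
    rintro ⟨-, γ, hγ, he⟩
    rw [smul_vt, vt, vt, toT_eq_iff hfin hsrc] at he
    obtain ⟨N, he, ⟨m, hm⟩, ⟨m', hm'⟩⟩ :=
      (he.and ((eventually_natVec (γ.toAdd + n)).and (eventually_natVec n))).exists
    obtain ⟨p, rfl, rfl⟩ := (existsUnique_of_mem_leaves hv m).exists
    obtain ⟨q, hq, rfl⟩ := (existsUnique_of_mem_leaves hv m').exists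
    rw [hm, push_gen_of_mem_leaves hv, ← hm, hm', ← hq, push_gen_of_mem_leaves (hq ▸ hv),
      Finsupp.single_left_inj one_ne_zero] at he
    obtain rfl := h p q hv hq.symm he
    rw [hm] at hm'
    refine hγ (toAdd_eq_zero.1 ?_)
    simpa using hm'

/-- The element v(n) is prime, so it divides some member of s, and an atom divisible by a nonunit
equals it. -/
theorem mem_of_sum_eq_add (hfin : Λ.RowFinite) (hsrc : Λ.NoSources) (s : Multiset Λ.TMonoid)
    (hs : ∀ b ∈ s, AddIrreducible b) {v : V} (hv : v ∈ Λ.leaves) {n : Fin k → ℤ} {c : Λ.TMonoid}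
    (h : s.sum = Λ.vt v n + c) : Λ.vt v n ∈ s := by
  induction s using Multiset.induction generalizing c with
  | empty =>
    rw [Multiset.sum_zero] at h
    exact absurd (eq_zero_of_add_eq_zero hfin hsrc h.symm) (vt_ne_zero hfin hsrc v n)
  | cons a s ih =>
    rw [Multiset.sum_cons] at h
    rcases exists_eq_vt_add hfin hsrc hv h.symm with ⟨d, hd⟩ | ⟨d, hd⟩
    · rcases (hs a (Multiset.mem_cons_self _ _)).2 hd with h1 | h1
      · exact absurd ((isAddUnit_iff hfin hsrc).1 h1) (vt_ne_zero hfin hsrc v n)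
      · rw [(isAddUnit_iff hfin hsrc).1 h1, add_zero] at hd
        exact hd ▸ Multiset.mem_cons_self _ _
    · exact Multiset.mem_cons_of_mem (ih (fun b hb => hs b (Multiset.mem_cons_of_mem hb)) hd)

/-- If γ fixes the sum of S, then every γ^j carries a chosen atom of S into S. As S is finite, two
of these images agree, and γ^(j-i) fixes the atom; it is nontrivial because ℤ^k is torsion-free. -/
theorem actsFreely_of_atomic (hfin : Λ.RowFinite) (hsrc : Λ.NoSources)
    (hat : IsAtomicMonoid Λ.TMonoid)
    (h : ∀ a : Λ.TMonoid, AddIrreducible a → IsAperiodicElt (Multiplicative (Fin k → ℤ)) a) :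
    ActsFreely (Multiplicative (Fin k → ℤ)) Λ.TMonoid := by
  classical
  rintro a ⟨ha, γ, hγ, he⟩
  obtain ⟨s, hs, rfl⟩ := hat a (fun hu => ha ((isAddUnit_iff hfin hsrc).1 hu))
  obtain ⟨b, hb⟩ := Multiset.exists_mem_of_ne_zero (s := s) (by rintro rfl; simp at ha)
  obtain ⟨t, rfl⟩ := Multiset.exists_cons_of_mem hb
  obtain ⟨v, hv, n, rfl⟩ := (addIrreducible_iff hfin hsrc).1 (hs b hb)
  set S := Λ.vt v n ::ₘ t with hS
  have hpow (j : ℕ) : γ ^ j • S.sum = S.sum := by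
    induction j with
    | zero => simp
    | succ j ih => rw [pow_succ, mul_smul, he, ih]
  have hmem (j : ℕ) : γ ^ j • Λ.vt v n ∈ S := by
    have h1 := hpow j
    conv_lhs at h1 => rw [hS, Multiset.sum_cons, smul_add]
    rw [smul_vt] at h1 ⊢
    exact mem_of_sum_eq_add hfin hsrc S hs hv h1.symm
  have hninj : ¬ Function.Injective fun j : ℕ => γ ^ j • Λ.vt v n := by
    intro hinj
    refine Set.infinite_of_injective_forall_mem hinj (s := {x | x ∈ S.toFinset}) ?_ ?_
    · intro j
      simpa using hmem j
    · exact S.toFinset.finite_toSet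
  have hper : ∀ i j : ℕ, i < j → γ ^ i • Λ.vt v n ≠ γ ^ j • Λ.vt v n := by
    intro i j hij heq
    refine (h _ (hs _ hb)).2 ⟨vt_ne_zero hfin hsrc v n, γ ^ (j - i), ?_, ?_⟩
    · intro h1
      refine hγ (toAdd_eq_zero.1 ?_)
      have h2 := congrArg Multiplicative.toAdd h1
      rw [toAdd_pow, toAdd_one] at h2
      exact (smul_eq_zero.1 h2).resolve_left (by omega)
    · have : γ ^ j = γ ^ i * γ ^ (j - i) := by rw [← pow_add]; congr 1; omega
      rw [this, mul_smul] at heq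
      exact (smul_left_cancel _ heq).symm
  refine hninj fun i j hij => ?_
  rcases lt_trichotomy i j with h1 | h1 | h1
  · exact absurd hij (hper i j h1)
  · exact h1
  · exact absurd hij.symm (hper j i h1)

end KGraph

/-- The left ideal generated by `z` lies in the socle if it is generated by each of its nonzero
elements. -/
theorem mul_mem_leftSocle {A : Type*} [NonUnitalRing A] {z e : A} (he : e * z = z)
    (h : ∀ y, y * z ≠ 0 → ∃ t, t * (y * z) = z) (x : A) : x * z ∈ leftSocle A := by
  by_cases hz : z = 0
  · rw [hz, mul_zero]
    exact zero_mem _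
  have hmin : IsMinimalLeftIdeal (AddMonoidHom.mulRight z).range := by
    refine ⟨⟨?_, ?_⟩, ?_⟩
    · rintro a _ ⟨y, rfl⟩
      exact ⟨a * y, mul_assoc a y z⟩
    · intro hbot
      -- Without an identity, z ∈ Az is not automatic; the left unit e provides it.
      have : z ∈ (AddMonoidHom.mulRight z).range := ⟨e, he⟩
      rw [hbot] at this
      exact hz this
    · rintro J ⟨hJ, hJ0⟩ hle
      obtain ⟨⟨y, hy⟩, hne⟩ := AddSubgroup.ne_bot_iff_exists_ne_zero.1 hJ0
      have hy0 : y ≠ 0 := fun h0 => hne (Subtype.ext h0)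
      obtain ⟨a, ha⟩ := hle hy
      obtain ⟨t, ht⟩ := h a (by rw [show a * z = y from ha]; exact hy0)
      have hzJ : z ∈ J := by
        rw [← ht]
        refine hJ t _ ?_
        rw [show a * z = y from ha]
        exact hy
      rintro _ ⟨b, rfl⟩
      exact hJ b z hzJ
  exact (le_sSup (α := AddSubgroup A) hmin : _ ≤ leftSocle A) ⟨x, rfl⟩

/-! ### Kumjian-Pask families and sufficiency of the leaf conditions -/

namespace KGraph

variable {k : ℕ} {V : Type u} [Category.{w} V] {Λ : KGraph k V}

namespace KPFamily

variable {A : Type*} [NonUnitalRing A] (F : Λ.KPFamily A)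

theorem S_comp {a b c : V} (p : b ⟶ c) (q : a ⟶ b) :
    F.S (GPath.of (q ≫ p)) = F.S (GPath.of p) * F.S (GPath.of q) := (F.S_mul p q).symm

theorem Sst_comp {a b c : V} (p : b ⟶ c) (q : a ⟶ b) :
    F.Sst (GPath.of (q ≫ p)) = F.Sst (GPath.of q) * F.Sst (GPath.of p) := (F.Sst_mul p q).symm

theorem P_mul_S_of_ne {v : V} {p : GPath V} (h : v ≠ p.rng) : F.P v * F.S p = 0 := by
  rw [← F.P_mul_S p, ← mul_assoc, F.P_mul_ne v _ h, zero_mul]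

theorem S_mul_P_of_ne {v : V} {p : GPath V} (h : p.src ≠ v) : F.S p * F.P v = 0 := by
  rw [← F.S_mul_P p, mul_assoc, F.P_mul_ne _ v h, mul_zero]

theorem Sst_mul_P_of_ne {v : V} {p : GPath V} (h : p.rng ≠ v) : F.Sst p * F.P v = 0 := by
  rw [← F.Sst_mul_P p, mul_assoc, F.P_mul_ne _ v h, mul_zero]

theorem S_mul_S_of_ne {p q : GPath V} (h : p.src ≠ q.rng) : F.S p * F.S q = 0 := by
  rw [← F.P_mul_S q, ← mul_assoc, F.S_mul_P_of_ne h, zero_mul]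

theorem Sst_mul_S_of_ne {p q : GPath V} (h : p.rng ≠ q.rng) : F.Sst p * F.S q = 0 := by
  rw [← F.P_mul_S q, ← mul_assoc, F.Sst_mul_P_of_ne h, zero_mul]

theorem Sst_mul_Sst_of_ne {p q : GPath V} (h : p.rng ≠ q.src) : F.Sst p * F.Sst q = 0 := by
  rw [← F.P_mul_Sst q, ← mul_assoc, F.Sst_mul_P_of_ne h, zero_mul]

theorem S_mul_Sst_mul_S (p : GPath V) : F.S p * F.Sst p * F.S p = F.S p := by
  rw [mul_assoc, F.Sst_mul_S_self, F.S_mul_P]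

theorem Sst_mul_S_mul_Sst (p : GPath V) : F.Sst p * F.S p * F.Sst p = F.Sst p := by
  rw [F.Sst_mul_S_self, F.P_mul_Sst]

theorem P_mul_Sst_of {a b : V} (β : a ⟶ b) :
    F.P a * F.Sst (GPath.of β) = F.Sst (GPath.of β) := F.P_mul_Sst (GPath.of β)

theorem P_mul_S_of {a b : V} (β : a ⟶ b) :
    F.P b * F.S (GPath.of β) = F.S (GPath.of β) := F.P_mul_S (GPath.of β)

theorem Sst_of_mul_P {a b : V} (β : a ⟶ b) :
    F.Sst (GPath.of β) * F.P b = F.Sst (GPath.of β) := F.Sst_mul_P (GPath.of β)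

/-- Write q = gr with d(g) = d(p): either g = p and it cancels, or the product vanishes. -/
theorem Sst_mul_S_eq (p q : GPath V) {n : Fin k → ℕ} (h : Λ.degree q = Λ.degree p + n) :
    F.Sst p * F.S q = 0 ∨
      ∃ r : q.src ⟶ p.src, q = GPath.of (r ≫ p.hom) ∧ F.Sst p * F.S q = F.S (GPath.of r) := by
  obtain ⟨c, g, r, hq, hg, -⟩ := exists_factor q h
  have he : F.S q = F.S (GPath.of g) * F.S (GPath.of r) := (congrArg F.S hq).trans (F.S_comp g r)
  by_cases hp : p = GPath.of g
  · right
    subst hp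
    refine ⟨r, hq, ?_⟩
    rw [he, ← mul_assoc, F.Sst_mul_S_self]
    exact F.P_mul_S (GPath.of r)
  · left
    rw [he, ← mul_assoc, F.Sst_mul_S_ne p (GPath.of g) hg.symm hp, zero_mul]

theorem Sst_mul_S_eq' (p q : GPath V) {n : Fin k → ℕ} (h : Λ.degree q = Λ.degree p + n) :
    F.Sst q * F.S p = 0 ∨
      ∃ r : q.src ⟶ p.src, q = GPath.of (r ≫ p.hom) ∧ F.Sst q * F.S p = F.Sst (GPath.of r) := by
  obtain ⟨c, g, r, hq, hg, -⟩ := exists_factor q h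
  have he : F.Sst q = F.Sst (GPath.of r) * F.Sst (GPath.of g) :=
    (congrArg F.Sst hq).trans (F.Sst_comp g r)
  by_cases hp : p = GPath.of g
  · right
    subst hp
    refine ⟨r, hq, ?_⟩
    rw [he, mul_assoc, F.Sst_mul_S_self]
    exact F.Sst_mul_P (GPath.of r)
  · left
    rw [he, mul_assoc, F.Sst_mul_S_ne (GPath.of g) p hg (Ne.symm hp), mul_zero]

theorem P_eq_toFinset_sum (hfin : Λ.RowFinite) (v : V) (n : Fin k → ℕ) :
    F.P v = ∑ p ∈ (hfin v n).toFinset, F.S p * F.Sst p := by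
  rw [F.P_eq_sum v n, finsum_mem_eq_finite_toFinset_sum _ (hfin v n)]

theorem S_mul_Sst_of_leaf {p : GPath V} (hp : p.rng ∈ Λ.leaves) : F.S p * F.Sst p = F.P p.rng := by
  have : Λ.pathsTo p.rng (Λ.degree p) = {p} :=
    Set.eq_singleton_iff_unique_mem.2 ⟨⟨rfl, rfl⟩, fun q hq =>
      (existsUnique_of_mem_leaves hp _).unique hq ⟨rfl, rfl⟩⟩
  rw [F.P_eq_sum p.rng (Λ.degree p), this, finsum_mem_singleton]

variable (K : Type*) [Field K] [Module K A]

/-- The linear span of the elements `S_α S_{β*}` with `s(α) = s(β)`. -/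
def spanSSst : Submodule K A :=
  Submodule.span K {x | ∃ (a b c : V) (α : a ⟶ b) (β : a ⟶ c),
    x = F.S (GPath.of α) * F.Sst (GPath.of β)}

variable {K}

theorem S_mul_Sst_mem {a b c : V} (α : a ⟶ b) (β : a ⟶ c) :
    F.S (GPath.of α) * F.Sst (GPath.of β) ∈ F.spanSSst K :=
  Submodule.subset_span ⟨a, b, c, α, β, rfl⟩

/-- Insert P_{r(q)} = ∑ s_l s_{l*} over the paths l of degree d(p) ∨ d(q): each l then absorbs both
p and q or gives 0. -/
theorem Sst_mul_S_mem (hfin : Λ.RowFinite) (p q : GPath V) : F.Sst p * F.S q ∈ F.spanSSst K := by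
  by_cases h : p.rng = q.rng
  · rw [← F.P_mul_S q, F.P_eq_toFinset_sum hfin q.rng (Λ.degree p ⊔ Λ.degree q), Finset.sum_mul,
      Finset.mul_sum]
    refine Submodule.sum_mem _ fun l hl => ?_
    have hl' : Λ.degree l = Λ.degree p ⊔ Λ.degree q := by
      have : l ∈ Λ.pathsTo q.rng (Λ.degree p ⊔ Λ.degree q) := by simpa using hl
      exact this.2
    have he : F.Sst p * (F.S l * F.Sst l * F.S q) = (F.Sst p * F.S l) * (F.Sst l * F.S q) := by
      simp only [mul_assoc]
    rw [he]
    rcases F.Sst_mul_S_eq p l (n := Λ.degree l - Λ.degree p)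
      (by rw [add_tsub_cancel_of_le]; rw [hl']; exact le_sup_left) with h1 | ⟨r, -, h1⟩
    · rw [h1, zero_mul]
      exact zero_mem _
    rcases F.Sst_mul_S_eq' q l (n := Λ.degree l - Λ.degree q)
      (by rw [add_tsub_cancel_of_le]; rw [hl']; exact le_sup_right) with h2 | ⟨t, -, h2⟩
    · rw [h2, mul_zero]
      exact zero_mem _
    rw [h1, h2]
    exact F.S_mul_Sst_mem r t
  · rw [F.Sst_mul_S_of_ne h]
    exact zero_mem _

theorem S_mem_spanSSst (p : GPath V) : F.S p ∈ F.spanSSst K := by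
  have := F.S_mul_Sst_mem (K := K) p.hom (𝟙 p.src)
  rwa [F.Sst_id, of_hom, F.S_mul_P] at this

theorem Sst_mem_spanSSst (p : GPath V) : F.Sst p ∈ F.spanSSst K := by
  have := F.S_mul_Sst_mem (K := K) (𝟙 p.src) p.hom
  rwa [F.S_id, of_hom, F.P_mul_Sst] at this

theorem P_mem_spanSSst (v : V) : F.P v ∈ F.spanSSst K := by
  rw [← F.S_id]
  exact F.S_mem_spanSSst _

variable [SMulCommClass K A A]

/-- The vertices provide local units. -/
theorem exists_P_mul_ne_zero {x : A} (hx : x ∈ F.spanSSst K) (hx0 : x ≠ 0) :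
    ∃ v, F.P v * x ≠ 0 := by
  classical
  -- Allowing every larger E' makes the claim additive in x.
  have key : ∃ E : Finset V, ∀ E', E ⊆ E' → ∑ v ∈ E', F.P v * x = x := by
    clear hx0
    induction hx using Submodule.span_induction with
    | mem x hx =>
      obtain ⟨a, b, c, α, β, rfl⟩ := hx
      refine ⟨{b}, fun E' hE => ?_⟩
      rw [Finset.sum_eq_single b]
      · rw [← mul_assoc, F.P_mul_S_of]
      · intro v _ hv
        rw [← mul_assoc, F.P_mul_S_of_ne hv, zero_mul]
      · intro hb
        exact absurd (hE (Finset.mem_singleton_self b)) hb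
    | zero => exact ⟨∅, by simp⟩
    | add x y _ _ hx hy =>
      obtain ⟨E₁, h₁⟩ := hx
      obtain ⟨E₂, h₂⟩ := hy
      refine ⟨E₁ ∪ E₂, fun E' hE => ?_⟩
      simp only [mul_add, Finset.sum_add_distrib]
      rw [h₁ _ (Finset.union_subset_left hE), h₂ _ (Finset.union_subset_right hE)]
    | smul r x _ hx =>
      obtain ⟨E, h⟩ := hx
      refine ⟨E, fun E' hE => ?_⟩
      simp only [mul_smul_comm]
      rw [← Finset.smul_sum, h _ hE]
  by_contra! h
  obtain ⟨E, hE⟩ := key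
  apply hx0
  rw [← hE E subset_rfl]
  simp [h]

/-- A ghost path of large degree absorbs every real path occurring in x, leaving only ghost paths.
-/
theorem exists_Sst_mul_mem_span {x : A} (hx : x ∈ F.spanSSst K) :
    ∃ N : Fin k → ℕ, ∀ α : GPath V, N ≤ Λ.degree α →
      F.Sst α * x ∈ Submodule.span K
        {y | ∃ (b : V) (β : α.src ⟶ b), y = F.Sst (GPath.of β)} := by
  induction hx using Submodule.span_induction with
  | mem x hx =>
    obtain ⟨a, b, c, γ, δ, rfl⟩ := hx
    refine ⟨Λ.deg γ, fun α hα => ?_⟩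
    rw [← mul_assoc]
    rcases F.Sst_mul_S_eq' (GPath.of γ) α (n := Λ.degree α - Λ.deg γ)
      (add_tsub_cancel_of_le hα).symm with h | ⟨r, -, h⟩
    · rw [h, zero_mul]
      exact zero_mem _
    · rw [h]
      exact Submodule.subset_span ⟨c, r ≫ δ, (F.Sst_comp δ r).symm⟩
  | zero => exact ⟨0, fun α _ => by simp⟩
  | add x y _ _ hx hy =>
    obtain ⟨N₁, h₁⟩ := hx
    obtain ⟨N₂, h₂⟩ := hy
    refine ⟨N₁ ⊔ N₂, fun α hα => ?_⟩
    rw [mul_add]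
    exact add_mem (h₁ α (le_sup_left.trans hα)) (h₂ α (le_sup_right.trans hα))
  | smul r x _ hx =>
    obtain ⟨N, h⟩ := hx
    refine ⟨N, fun α hα => ?_⟩
    rw [mul_smul_comm]
    exact Submodule.smul_mem _ r (h α hα)

variable [IsScalarTower K A A]

theorem S_mul_mul_Sst_mem {p q : GPath V} {x : A} (hx : x ∈ F.spanSSst K) :
    F.S p * x * F.Sst q ∈ F.spanSSst K := by
  induction hx using Submodule.span_induction with
  | mem x hx =>
    obtain ⟨a, b, c, α, β, rfl⟩ := hx
    have he : F.S p * (F.S (GPath.of α) * F.Sst (GPath.of β)) * F.Sst q =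
        (F.S p * F.S (GPath.of α)) * (F.Sst (GPath.of β) * F.Sst q) := by
      simp only [mul_assoc]
    rw [he]
    obtain ⟨a₁, b₁, f⟩ := p
    obtain ⟨a₂, b₂, g⟩ := q
    by_cases h1 : a₁ = b
    · by_cases h2 : c = a₂
      · subst h1 h2
        rw [show (⟨_, _, f⟩ : GPath V) = GPath.of f from rfl,
          show (⟨_, _, g⟩ : GPath V) = GPath.of g from rfl, F.S_mul, F.Sst_mul]
        exact F.S_mul_Sst_mem _ _
      · rw [F.Sst_mul_Sst_of_ne h2, mul_zero]
        exact zero_mem _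
    · rw [F.S_mul_S_of_ne h1, zero_mul]
      exact zero_mem _
  | zero => simp
  | add x y _ _ hx hy =>
    rw [mul_add, add_mul]
    exact add_mem hx hy
  | smul r x _ hx =>
    rw [mul_smul_comm, smul_mul_assoc]
    exact Submodule.smul_mem _ r hx

theorem mul_mem_spanSSst (hfin : Λ.RowFinite) {x y : A} (hx : x ∈ F.spanSSst K)
    (hy : y ∈ F.spanSSst K) : x * y ∈ F.spanSSst K := by
  induction hx using Submodule.span_induction with
  | mem x hx =>
    obtain ⟨a, b, c, α, β, rfl⟩ := hx
    induction hy using Submodule.span_induction with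
    | mem y hy =>
      obtain ⟨a', b', c', γ, δ, rfl⟩ := hy
      have he : F.S (GPath.of α) * F.Sst (GPath.of β) * (F.S (GPath.of γ) * F.Sst (GPath.of δ)) =
          F.S (GPath.of α) * (F.Sst (GPath.of β) * F.S (GPath.of γ)) * F.Sst (GPath.of δ) := by
        simp only [mul_assoc]
      rw [he]
      exact F.S_mul_mul_Sst_mem (F.Sst_mul_S_mem hfin _ _)
    | zero => simp
    | add x y _ _ hx hy =>
      rw [mul_add]
      exact add_mem hx hy
    | smul r x _ hx =>
      rw [mul_smul_comm]
      exact Submodule.smul_mem _ r hx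
  | zero => simp
  | add x y _ _ hx hy =>
    rw [add_mul]
    exact add_mem hx hy
  | smul r x _ hx =>
    rw [smul_mul_assoc]
    exact Submodule.smul_mem _ r hx

/-- If `w` is a leaf and `x P_w = x ≠ 0`, then `P_w` is a left multiple of `x`. -/
theorem exists_mul_eq_P (hfin : Λ.RowFinite) (hR : Λ.RigidLeaves) {v : V}
    (hv : v ∈ Λ.leaves) {x : A} (hx : x ∈ F.spanSSst K) (hxv : x * F.P v = x) (hx0 : x ≠ 0) :
    ∃ t, t * x = F.P v := by
  obtain ⟨N, hN⟩ := F.exists_Sst_mul_mem_span hx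
  obtain ⟨u, hu⟩ := F.exists_P_mul_ne_zero hx hx0
  -- Since P_u = ∑ s_α s_{α*} over uΛᴺ, some s_{α*} x is nonzero; it is a combination of ghost
  -- paths.
  obtain ⟨α, hα, hα0⟩ : ∃ α ∈ Λ.pathsTo u N, F.Sst α * x ≠ 0 := by
    by_contra! h
    apply hu
    rw [F.P_eq_toFinset_sum hfin u N, Finset.sum_mul]
    refine Finset.sum_eq_zero fun α hα => ?_
    rw [mul_assoc, h α (by simpa using hα), mul_zero]
  have hmem := hN α hα.2.ge
  have hsx : F.Sst α * x = F.Sst α * x * F.P v := by rw [mul_assoc, hxv]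
  by_cases hβ : Nonempty (α.src ⟶ v)
  · obtain ⟨β⟩ := hβ
    -- Right multiplication by P_v keeps only the ghosts of paths from s(α) to v, and by rigidity β
    -- is the only one.
    have key : ∀ y ∈ Submodule.span K {y | ∃ (b : V) (β : α.src ⟶ b), y = F.Sst (GPath.of β)},
        ∃ c : K, y * F.P v = c • F.Sst (GPath.of β) := by
      intro y hy
      induction hy using Submodule.span_induction with
      | mem y hy =>
        obtain ⟨b, δ, rfl⟩ := hy
        by_cases hb : b = v
        · subst hb
          refine ⟨1, ?_⟩
          rw [F.Sst_of_mul_P, one_smul, hR (GPath.of δ) (GPath.of β) hv rfl rfl]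
        · exact ⟨0, by rw [F.Sst_mul_P_of_ne hb, zero_smul]⟩
      | zero => exact ⟨0, by simp⟩
      | add y z _ _ hy hz =>
        obtain ⟨c, hc⟩ := hy
        obtain ⟨d, hd⟩ := hz
        exact ⟨c + d, by rw [add_mul, hc, hd, add_smul]⟩
      | smul r y _ hy =>
        obtain ⟨c, hc⟩ := hy
        exact ⟨r * c, by rw [smul_mul_assoc, hc, mul_smul]⟩
    obtain ⟨c, hc⟩ := key _ hmem
    have hc0 : c ≠ 0 := by
      rintro rfl
      rw [hsx, hc, zero_smul] at hα0
      exact hα0 rfl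
    -- As s_{α*} x = c s_{β*}, this multiplier gives s_β s_{β*}, which is P_v because v is a leaf.
    refine ⟨c⁻¹ • (F.S (GPath.of β) * F.Sst α), ?_⟩
    rw [smul_mul_assoc, mul_assoc, hsx, hc, mul_smul_comm, inv_smul_smul₀ hc0]
    exact F.S_mul_Sst_of_leaf (p := GPath.of β) hv
  · refine absurd ?_ hα0
    rw [hsx]
    generalize F.Sst α * x = y at hmem
    induction hmem using Submodule.span_induction with
    | mem y hy =>
      obtain ⟨b, δ, rfl⟩ := hy
      refine F.Sst_mul_P_of_ne ?_
      rintro rfl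
      exact hβ ⟨δ⟩
    | zero => simp
    | add y z _ _ hy hz => rw [add_mul, hy, hz, add_zero]
    | smul r y _ hy => rw [smul_mul_assoc, hy, smul_zero]

/-- Right multiplication by s_p identifies A s_{p*} with A P_{s(p)}, where every nonzero element is
a generator. -/
theorem mul_Sst_mem_leftSocle (hfin : Λ.RowFinite) (hR : Λ.RigidLeaves)
    (hspan : F.spanSSst K = ⊤) {p : GPath V} (hp : p.src ∈ Λ.leaves) (x : A) :
    x * F.Sst p ∈ leftSocle A := by
  refine mul_mem_leftSocle (F.P_mul_Sst p) (fun y hy => ?_) x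
  have h0 : y * F.Sst p * F.S p ≠ 0 := by
    intro h
    apply hy
    rw [← F.Sst_mul_S_mul_Sst, ← mul_assoc, ← mul_assoc, h, zero_mul]
  obtain ⟨t, ht⟩ := F.exists_mul_eq_P hfin hR hp (K := K) (x := y * F.Sst p * F.S p)
    (by rw [hspan]; trivial) (by rw [mul_assoc, F.S_mul_P]) h0
  refine ⟨t, ?_⟩
  have := congrArg (· * F.Sst p) ht
  simp only [F.P_mul_Sst] at this
  rw [mul_assoc t, mul_assoc y, mul_assoc y, F.Sst_mul_S_mul_Sst] at this
  exact this

/-- Expanding P_{s(α)} between the factors gives s_α s_{β*} = ∑ s_{αl} s_{(βl)*}, where all the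
paths l have leaf sources. -/
theorem isSemisimple_of_leafBound (hfin : Λ.RowFinite) (hL : Λ.LeafBound) (hR : Λ.RigidLeaves)
    (hspan : F.spanSSst K = ⊤) : IsSemisimpleNonUnital A := by
  refine eq_top_iff.2 fun x _ => ?_
  -- The socle is only an additive subgroup, so scalars have to be carried through the induction.
  have key : ∀ c : K, c • x ∈ leftSocle A := by
    have hx : x ∈ F.spanSSst K := by rw [hspan]; trivial
    clear * - hx hfin hL hR hspan
    induction hx using Submodule.span_induction with
    | mem x hx =>
      intro r
      obtain ⟨a, b, c, α, β, rfl⟩ := hx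
      obtain ⟨n, hn⟩ := hL a
      rw [← F.P_mul_Sst_of β, F.P_eq_toFinset_sum hfin a n, Finset.sum_mul, Finset.mul_sum,
        Finset.smul_sum]
      refine AddSubgroup.sum_mem _ fun l hl => ?_
      obtain ⟨e, a', l⟩ := l
      have hl' : (⟨e, a', l⟩ : GPath V) ∈ Λ.pathsTo a n := by simpa using hl
      obtain rfl : a' = a := hl'.1
      have he : F.S (GPath.of α) * (F.S ⟨e, a', l⟩ * F.Sst ⟨e, a', l⟩ * F.Sst (GPath.of β)) =
          F.S (GPath.of α) * F.S ⟨e, a', l⟩ * F.Sst (GPath.of (l ≫ β)) := by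
        rw [F.Sst_comp]
        simp only [mul_assoc]
        rfl
      rw [he, ← smul_mul_assoc]
      have hle : e ∈ Λ.leaves := hn _ hl'
      exact F.mul_Sst_mem_leftSocle hfin hR hspan (p := GPath.of (l ≫ β)) hle _
    | zero => intro c; simp
    | add x y _ _ hx hy =>
      intro c
      rw [smul_add]
      exact add_mem (hx c) (hy c)
    | smul r x _ hx =>
      intro c
      rw [smul_smul]
      exact hx (c * r)
  simpa using key 1

end KPFamily

/-- The Kumjian-Pask algebra is spanned by the elements `s_α s_{β*}`. -/
theorem spanSSst_kpFamily (hfin : Λ.RowFinite) (K : Type*) [Field K] :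
    (Λ.kpFamily K hfin).spanSSst K = ⊤ := by
  refine eq_top_iff.2 fun x _ => ?_
  obtain ⟨x, hx⟩ := x
  induction hx using NonUnitalAlgebra.adjoin_induction with
  | mem x hx =>
    obtain ⟨y, rfl⟩ := hx
    cases y with
    | vertex v => exact (Λ.kpFamily K hfin).P_mem_spanSSst v
    | path p => exact (Λ.kpFamily K hfin).S_mem_spanSSst p
    | ghost p => exact (Λ.kpFamily K hfin).Sst_mem_spanSSst p
  | zero => exact zero_mem _
  | add x y hx hy ihx ihy => exact add_mem (ihx trivial) (ihy trivial)
  | mul x y hx hy ihx ihy =>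
    exact (Λ.kpFamily K hfin).mul_mem_spanSSst hfin (ihx trivial) (ihy trivial)
  | smul r x hx ihx => exact Submodule.smul_mem _ r (ihx trivial)

end KGraph

/-! ### Semisimple rings without identity, as modules -/

section NonUnital

variable (A : Type*) [NonUnitalRing A]

/-- The ring of additive maps generated by the left multiplications. -/
def leftMulRing : Subring (AddMonoid.End A) :=
  Subring.closure (Set.range fun a : A => (AddMonoidHom.mulLeft a : AddMonoid.End A))

variable {A}

theorem leftMulRing_smul_mul (r : leftMulRing A) (x y : A) : r • x * y = r • (x * y) := by
  obtain ⟨r, hr⟩ := r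
  change r x * y = r (x * y)
  induction hr using Subring.closure_induction generalizing x y with
  | mem f hf =>
    obtain ⟨a, rfl⟩ := hf
    exact mul_assoc a x y
  | zero => exact zero_mul y
  | one => rfl
  | add f g _ _ hf hg => exact (add_mul _ _ _).trans (congrArg₂ _ (hf x y) (hg x y))
  | neg f _ hf => exact (neg_mul _ _).trans (congrArg _ (hf x y))
  | mul f g _ _ hf hg => exact (hf (g x) y).trans (congrArg f (hg x y))

theorem mul_mem_submodule (N : Submodule (leftMulRing A) A) (a : A) {x : A} (hx : x ∈ N) :
    a * x ∈ N :=
  N.smul_mem ⟨AddMonoidHom.mulLeft a, Subring.subset_closure ⟨a, rfl⟩⟩ hx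

/-- A left ideal as a submodule. -/
def IsLeftIdeal.toSubmodule {I : AddSubgroup A} (hI : IsLeftIdeal I) :
    Submodule (leftMulRing A) A :=
  { I with
    smul_mem' := by
      rintro ⟨r, hr⟩ x hx
      change r x ∈ I
      replace hx : x ∈ I := hx
      induction hr using Subring.closure_induction generalizing x with
      | mem f hf =>
        obtain ⟨a, rfl⟩ := hf
        exact hI a x hx
      | zero => exact I.zero_mem
      | one => exact hx
      | add f g _ _ hf hg => exact I.add_mem (hf hx) (hg hx)
      | neg f _ hf => exact I.neg_mem (hf hx)
      | mul f g _ _ hf hg => exact hf (hg hx) }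

theorem IsMinimalLeftIdeal.isAtom {I : AddSubgroup A} (hI : IsMinimalLeftIdeal I) :
    IsAtom hI.1.1.toSubmodule := by
  refine ⟨fun h => hI.1.2 ?_, fun N hN => ?_⟩
  · exact (AddSubgroup.eq_bot_iff_forall I).2 fun x hx =>
      (Submodule.mem_bot (leftMulRing A)).1 (h ▸ (show x ∈ hI.1.1.toSubmodule from hx))
  · by_contra h0
    refine hN.not_ge (hI.2 (y := N.toAddSubgroup) ⟨fun a x hx => mul_mem_submodule N a hx, ?_⟩
      hN.le)
    intro hbot
    refine h0 ((Submodule.eq_bot_iff N).2 fun x hx => ?_)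
    exact AddSubgroup.mem_bot.1 (hbot ▸ (show x ∈ N.toAddSubgroup from hx))

/-- The ring `leftMulRing A` has an identity and its submodules of A are the left ideals, so minimal
left ideals become simple submodules. -/
theorem IsSemisimpleNonUnital.isSemisimpleModule (h : IsSemisimpleNonUnital A) :
    IsSemisimpleModule (leftMulRing A) A := by
  refine .of_sSup_simples_eq_top (eq_top_iff.2 ?_)
  set T := sSup {m : Submodule (leftMulRing A) A | IsSimpleModule (leftMulRing A) m}
  have hle : leftSocle A ≤ T.toAddSubgroup := by
    refine sSup_le fun I hI => ?_
    have : hI.1.1.toSubmodule ≤ T := le_sSup (isSimpleModule_iff_isAtom.2 hI.isAtom)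
    exact this
  intro x _
  exact hle (h ▸ AddSubgroup.mem_top x)

/-- Semisimple rings are von Neumann regular. -/
theorem IsSemisimpleNonUnital.exists_mul_mul_eq (h : IsSemisimpleNonUnital A) {a e : A}
    (h1 : a * e = a) (h2 : e * a = a) : ∃ y, a * y * a = a := by
  have := h.isSemisimpleModule
  obtain ⟨C, hC⟩ := exists_isCompl (Submodule.span (leftMulRing A) {a})
  have he : e ∈ Submodule.span (leftMulRing A) {a} ⊔ C := by rw [hC.sup_eq_top]; trivial
  obtain ⟨t, ht, c, hc, rfl⟩ := Submodule.mem_sup.1 he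
  obtain ⟨r, rfl⟩ := Submodule.mem_span_singleton.1 ht
  -- The component c of e is annihilated by a, because ac = a - a(r • a) lies in both complementary
  -- summands.
  have hac : a * c = 0 := by
    have hmem : a * c ∈ Submodule.span (leftMulRing A) {a} ⊓ C := by
      refine ⟨?_, mul_mem_submodule C a hc⟩
      have hac : a * c = a - a * r • a := by
        rw [eq_sub_iff_add_eq, add_comm, ← mul_add, h1]
      rw [hac]
      exact sub_mem (Submodule.mem_span_singleton_self a) (mul_mem_submodule _ a ht)
    rwa [hC.inf_eq_bot] at hmem
  -- The operator r need not come from A, but r • e does lie in A and acts on a as r does.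
  refine ⟨r • (r • a + c), ?_⟩
  rw [mul_assoc, leftMulRing_smul_mul, h2]
  rwa [mul_add, hac, add_zero] at h1

/-- The descending chain condition on idempotents of a semisimple ring. -/
theorem IsSemisimpleNonUnital.exists_minimal (h : IsSemisimpleNonUnital A) {Q : A → Prop}
    (hQ : ∀ q, Q q → q * q = q) {q₀ : A} (h₀ : Q q₀) :
    ∃ q, Q q ∧ ∀ q', Q q' → q' * q = q' → q * q' = q := by
  have := h.isSemisimpleModule
  let N := Submodule.span (leftMulRing A) {q₀}
  -- A finitely generated semisimple module is Artinian.
  have : IsArtinian (leftMulRing A) N := inferInstance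
  obtain ⟨M, ⟨q, hq, hqN, rfl⟩, hmin⟩ := IsArtinian.set_has_minimal
    {M : Submodule (leftMulRing A) N | ∃ q, Q q ∧ q ∈ N ∧
      M = (Submodule.span (leftMulRing A) {q}).comap N.subtype}
    ⟨_, q₀, h₀, Submodule.mem_span_singleton_self q₀, rfl⟩
  refine ⟨q, hq, fun q' hq' hqq => ?_⟩
  have hmem : q' ∈ Submodule.span (leftMulRing A) {q} := by
    rw [← hqq]
    exact mul_mem_submodule _ _ (Submodule.mem_span_singleton_self q)
  have hle : Submodule.span (leftMulRing A) {q} ≤ N :=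
    (Submodule.span_singleton_le_iff_mem _ _).2 hqN
  have hle' : (Submodule.span (leftMulRing A) {q'}).comap N.subtype ≤
      (Submodule.span (leftMulRing A) {q}).comap N.subtype :=
    Submodule.comap_mono ((Submodule.span_singleton_le_iff_mem _ _).2 hmem)
  have heq := hle'.eq_of_not_lt (hmin _ ⟨q', hq', hle hmem, rfl⟩)
  have hq2 : (⟨q, hqN⟩ : N) ∈ (Submodule.span (leftMulRing A) {q'}).comap N.subtype := by
    rw [heq]
    exact Submodule.mem_span_singleton_self q
  obtain ⟨r, hr⟩ := Submodule.mem_span_singleton.1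
    (show q ∈ Submodule.span (leftMulRing A) {q'} from hq2)
  rw [← hr, leftMulRing_smul_mul, hQ q' hq']

end NonUnital

namespace KGraph

variable {k : ℕ} {V : Type u} [Category.{w} V] {Λ : KGraph k V}

/-! ### A representation of the Kumjian-Pask algebra on germs of functions on paths -/

section Representation

variable (K : Type*) [Field K]

open Classical in
/-- The operator `f ↦ (pμ ↦ f(μ))`. -/
noncomputable def opS (p : GPath V) : (GPath V → K) →ₗ[K] (GPath V → K) where
  toFun f μ := if h : Extends μ p then f (GPath.of h.choose_spec.choose) else 0
  map_add' f g := by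
    funext μ
    by_cases h : Extends μ p <;> simp [h]
  map_smul' r f := by
    funext μ
    by_cases h : Extends μ p <;> simp [h]

open Classical in
/-- The operator `f ↦ (μ ↦ f(pμ))`. -/
noncomputable def opSst (p : GPath V) : (GPath V → K) →ₗ[K] (GPath V → K) where
  toFun f μ := if h : μ.rng = p.src then f (GPath.of (μ.hom ≫ eqToHom h ≫ p.hom)) else 0
  map_add' f g := by
    funext μ
    by_cases h : μ.rng = p.src <;> simp [h]
  map_smul' r f := by
    funext μ
    by_cases h : μ.rng = p.src <;> simp [h]

open Classical in
/-- The restriction of functions to the paths with range `v`. -/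
noncomputable def opP (v : V) : (GPath V → K) →ₗ[K] (GPath V → K) where
  toFun f μ := if μ.rng = v then f μ else 0
  map_add' f g := by
    funext μ
    by_cases h : μ.rng = v <;> simp [h]
  map_smul' r f := by
    funext μ
    by_cases h : μ.rng = v <;> simp [h]

variable {K}

/-- The path chosen in the definition is unique by unique factorization, for which Λ is needed. -/
theorem opS_of (Λ : KGraph k V) (p : GPath V) (f : GPath V → K) {c : V} (q : c ⟶ p.src) :
    opS K p f (GPath.of (q ≫ p.hom)) = f (GPath.of q) := by
  have h : Extends (GPath.of (q ≫ p.hom)) p := ⟨c, q, rfl⟩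
  refine (dif_pos h).trans (congrArg f ?_)
  exact (of_comp_inj (Λ := Λ) h.choose_spec.choose_spec.symm rfl).2

theorem opS_of' (Λ : KGraph k V) {a b c : V} (p : a ⟶ b) (f : GPath V → K) (q : c ⟶ a) :
    opS K (GPath.of p) f (GPath.of (q ≫ p)) = f (GPath.of q) :=
  opS_of Λ (GPath.of p) f q

theorem opS_of_not {p μ : GPath V} (f : GPath V → K) (h : ¬ Extends μ p) : opS K p f μ = 0 :=
  dif_neg h

theorem opSst_of (p : GPath V) (f : GPath V → K) {c : V} (q : c ⟶ p.src) :
    opSst K p f (GPath.of q) = f (GPath.of (q ≫ p.hom)) := by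
  refine (dif_pos rfl).trans ?_
  change f (GPath.of (q ≫ 𝟙 _ ≫ p.hom)) = _
  rw [Category.id_comp]

theorem opSst_of' {a b c : V} (p : a ⟶ b) (f : GPath V → K) (q : c ⟶ a) :
    opSst K (GPath.of p) f (GPath.of q) = f (GPath.of (q ≫ p)) :=
  opSst_of (GPath.of p) f q

theorem opSst_of_ne {p μ : GPath V} (f : GPath V → K) (h : μ.rng ≠ p.src) : opSst K p f μ = 0 :=
  dif_neg h

theorem opP_of_eq {v : V} {μ : GPath V} (f : GPath V → K) (h : μ.rng = v) : opP K v f μ = f μ :=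
  if_pos h

theorem opP_of_ne {v : V} {μ : GPath V} (f : GPath V → K) (h : μ.rng ≠ v) : opP K v f μ = 0 :=
  if_neg h

theorem rng_eq_of_extends {p μ : GPath V} (h : Extends μ p) : μ.rng = p.rng := by
  obtain ⟨c, q, rfl⟩ := h
  rfl

theorem opS_id (Λ : KGraph k V) (v : V) : opS K (GPath.of (𝟙 v)) = opP K v := by
  ext1 f
  funext μ
  by_cases h : μ.rng = v
  · obtain ⟨a, b, μ⟩ := μ
    obtain rfl : b = v := h
    have := opS_of' Λ (𝟙 b) f μ
    rw [Category.comp_id] at this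
    exact this.trans (opP_of_eq f rfl).symm
  · rw [opP_of_ne f h, opS_of_not f (fun h' => h (rng_eq_of_extends h'))]

theorem opSst_id (v : V) : opSst K (GPath.of (𝟙 v)) = opP K v := by
  ext1 f
  funext μ
  by_cases h : μ.rng = v
  · obtain ⟨a, b, μ⟩ := μ
    obtain rfl : b = v := h
    have := opSst_of' (𝟙 b) f μ
    rw [Category.comp_id] at this
    exact this.trans (opP_of_eq f rfl).symm
  · rw [opP_of_ne f h, opSst_of_ne f h]

theorem opS_mul (Λ : KGraph k V) {a b c : V} (p : b ⟶ c) (q : a ⟶ b) (f : GPath V → K) :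
    opS K (GPath.of p) (opS K (GPath.of q) f) = opS K (GPath.of (q ≫ p)) f := by
  funext μ
  by_cases h : Extends μ (GPath.of p)
  · obtain ⟨d, (t : d ⟶ b), rfl⟩ := h
    change opS K (GPath.of p) _ (GPath.of (t ≫ p)) = opS K _ f (GPath.of (t ≫ p))
    rw [opS_of' Λ]
    by_cases h' : Extends (GPath.of t) (GPath.of q)
    · obtain ⟨e, (r : e ⟶ a), hr⟩ := h'
      change GPath.of t = GPath.of (r ≫ q) at hr
      obtain rfl : d = e := congrArg GPath.src hr
      obtain rfl : t = r ≫ q := of_inj.1 hr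
      rw [opS_of' Λ, Category.assoc, opS_of' Λ]
    · rw [opS_of_not f h', opS_of_not]
      rintro ⟨e, (r : e ⟶ a), hr⟩
      change GPath.of (t ≫ p) = GPath.of (r ≫ q ≫ p) at hr
      rw [← Category.assoc] at hr
      exact h' ⟨e, r, (of_comp_inj (Λ := Λ) hr rfl).2⟩
  · rw [opS_of_not _ h, opS_of_not]
    rintro ⟨e, (r : e ⟶ a), rfl⟩
    refine h ⟨e, r ≫ q, ?_⟩
    change GPath.of (r ≫ q ≫ p) = GPath.of ((r ≫ q) ≫ p)
    rw [Category.assoc]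

theorem opSst_mul {a b c : V} (p : b ⟶ c) (q : a ⟶ b) (f : GPath V → K) :
    opSst K (GPath.of q) (opSst K (GPath.of p) f) = opSst K (GPath.of (q ≫ p)) f := by
  funext μ
  by_cases h : μ.rng = a
  · obtain ⟨d, a', μ⟩ := μ
    obtain rfl : a' = a := h
    change opSst K (GPath.of q) _ (GPath.of μ) = opSst K _ f (GPath.of μ)
    rw [opSst_of', opSst_of', opSst_of', Category.assoc]
  · rw [opSst_of_ne _ h, opSst_of_ne _ h]

theorem opP_opS (p : GPath V) (f : GPath V → K) : opP K p.rng (opS K p f) = opS K p f := by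
  funext μ
  by_cases h : μ.rng = p.rng
  · rw [opP_of_eq _ h]
  · rw [opP_of_ne _ h, opS_of_not _ fun h' => h (rng_eq_of_extends h')]

theorem opS_opP (Λ : KGraph k V) (p : GPath V) (f : GPath V → K) :
    opS K p (opP K p.src f) = opS K p f := by
  funext μ
  by_cases h : Extends μ p
  · obtain ⟨c, q, rfl⟩ := h
    rw [opS_of Λ, opS_of Λ]
    exact opP_of_eq f rfl
  · rw [opS_of_not _ h, opS_of_not _ h]

theorem opP_opSst (p : GPath V) (f : GPath V → K) : opP K p.src (opSst K p f) = opSst K p f := by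
  funext μ
  by_cases h : μ.rng = p.src
  · rw [opP_of_eq _ h]
  · rw [opP_of_ne _ h, opSst_of_ne _ h]

theorem opSst_opP (p : GPath V) (f : GPath V → K) : opSst K p (opP K p.rng f) = opSst K p f := by
  funext μ
  by_cases h : μ.rng = p.src
  · obtain ⟨d, a, μ⟩ := μ
    obtain rfl : a = p.src := h
    change opSst K p _ (GPath.of μ) = opSst K p f (GPath.of μ)
    rw [opSst_of, opSst_of]
    exact opP_of_eq f rfl
  · rw [opSst_of_ne _ h, opSst_of_ne _ h]

theorem opSst_opS (Λ : KGraph k V) (p : GPath V) (f : GPath V → K) :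
    opSst K p (opS K p f) = opP K p.src f := by
  funext μ
  by_cases h : μ.rng = p.src
  · rw [opP_of_eq f h]
    obtain ⟨d, a, μ⟩ := μ
    obtain rfl : a = p.src := h
    change opSst K p _ (GPath.of μ) = f (GPath.of μ)
    rw [opSst_of, opS_of Λ]
  · rw [opSst_of_ne _ h, opP_of_ne _ h]

theorem opSst_opS_of_ne {p q : GPath V} (hd : Λ.degree p = Λ.degree q) (hpq : p ≠ q)
    (f : GPath V → K) : opSst K p (opS K q f) = 0 := by
  funext μ
  by_cases h : μ.rng = p.src
  · obtain ⟨d, a, μ⟩ := μ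
    obtain rfl : a = p.src := h
    change opSst K p _ (GPath.of μ) = 0
    rw [opSst_of, opS_of_not]
    rintro ⟨c, r, hr⟩
    exact hpq (of_comp_inj (Λ := Λ) hr hd).1
  · exact opSst_of_ne _ h

variable (Λ K)

/-- The functions that vanish on all the paths of large degree. -/
def vanishing : Submodule K (GPath V → K) where
  carrier := {f | ∃ n : Fin k → ℕ, ∀ μ, n ≤ Λ.degree μ → f μ = 0}
  zero_mem' := ⟨0, fun _ _ => rfl⟩
  add_mem' := by
    rintro f g ⟨m, hm⟩ ⟨n, hn⟩
    refine ⟨m ⊔ n, fun μ hμ => ?_⟩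
    rw [Pi.add_apply, hm μ (le_sup_left.trans hμ), hn μ (le_sup_right.trans hμ), add_zero]
  smul_mem' := by
    rintro r f ⟨n, hn⟩
    refine ⟨n, fun μ hμ => ?_⟩
    rw [Pi.smul_apply, hn μ hμ, smul_zero]

/-- Germs of functions on paths, as the degree of the paths tends to infinity. -/
abbrev PathGerm := (GPath V → K) ⧸ Λ.vanishing K

variable {Λ K}

theorem opS_vanishing (p : GPath V) : Λ.vanishing K ≤ (Λ.vanishing K).comap (opS K p) := by
  rintro f ⟨n, hn⟩
  refine ⟨n + Λ.degree p, fun μ hμ => ?_⟩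
  by_cases h : Extends μ p
  · obtain ⟨c, q, rfl⟩ := h
    rw [opS_of Λ]
    refine hn _ ?_
    rw [degree_of, Λ.deg_comp, add_comm (Λ.deg p.hom)] at hμ
    exact le_of_add_le_add_right hμ
  · exact opS_of_not _ h

theorem opSst_vanishing (p : GPath V) : Λ.vanishing K ≤ (Λ.vanishing K).comap (opSst K p) := by
  rintro f ⟨n, hn⟩
  refine ⟨n, fun μ hμ => ?_⟩
  by_cases h : μ.rng = p.src
  · obtain ⟨d, a, μ⟩ := μ
    obtain rfl : a = p.src := h
    change opSst K p _ (GPath.of μ) = 0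
    rw [opSst_of]
    refine hn _ ?_
    rw [degree_of, Λ.deg_comp]
    exact hμ.trans le_add_self
  · exact opSst_of_ne _ h

theorem opP_vanishing (v : V) : Λ.vanishing K ≤ (Λ.vanishing K).comap (opP K v) := by
  rw [← opSst_id]
  exact opSst_vanishing _

/-- A path of degree at least n has exactly one initial segment of degree n, so the two operators
agree there. On other paths they may differ, hence the passage to germs. -/
theorem opP_sub_sum_mem (hfin : Λ.RowFinite) (v : V) (n : Fin k → ℕ) (f : GPath V → K) :
    opP K v f - ∑ p ∈ (hfin v n).toFinset, opS K p (opSst K p f) ∈ Λ.vanishing K := by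
  refine ⟨n, fun μ hμ => ?_⟩
  rw [Pi.sub_apply, Finset.sum_apply, sub_eq_zero]
  by_cases h : μ.rng = v
  · subst h
    obtain ⟨c, g, r, hr, hg, -⟩ := exists_factor μ (add_tsub_cancel_of_le hμ).symm
    rw [opP_of_eq f rfl, Finset.sum_eq_single (GPath.of g)]
    · have h1 := opS_of' Λ g (opSst K (GPath.of g) f) r
      rw [← hr, opSst_of', ← hr] at h1
      exact h1.symm
    · intro p hp hpg
      refine opS_of_not _ ?_
      rintro ⟨d, q, hq⟩
      have hp' : p ∈ Λ.pathsTo μ.rng n := by simpa using hp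
      exact hpg (of_comp_inj (Λ := Λ) (hq.symm.trans hr) (hp'.2.trans hg.symm)).1
    · intro hne
      have hmem : GPath.of g ∈ Λ.pathsTo μ.rng n := ⟨rfl, hg⟩
      exact absurd ((hfin _ n).mem_toFinset.2 hmem) hne
  · rw [opP_of_ne f h, Finset.sum_eq_zero]
    intro p hp
    have hp' : p ∈ Λ.pathsTo v n := by simpa using hp
    exact opS_of_not _ fun h' => h ((rng_eq_of_extends h').trans hp'.1)

variable (K)

/-- The Kumjian-Pask family of operators on the germs of functions on paths. -/
noncomputable def germFamily (hfin : Λ.RowFinite) :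
    Λ.KPFamily (Module.End K (Λ.PathGerm K)) where
  P v := (Λ.vanishing K).mapQ _ (opP K v) (opP_vanishing v)
  S p := (Λ.vanishing K).mapQ _ (opS K p) (opS_vanishing p)
  Sst p := (Λ.vanishing K).mapQ _ (opSst K p) (opSst_vanishing p)
  S_id v := by simp only [opS_id Λ]
  Sst_id v := by simp only [opSst_id]
  P_mul_self v := Submodule.linearMap_qext _ <| LinearMap.ext fun f => congrArg (Λ.vanishing K).mkQ
    (show opP K v (opP K v f) = opP K v f by
      have := opP_opSst (GPath.of (𝟙 v)) f
      rwa [opSst_id] at this)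
  P_mul_ne v v' h := Submodule.linearMap_qext _ <| LinearMap.ext fun f =>
    congrArg (Λ.vanishing K).mkQ (show opP K v (opP K v' f) = 0 by
      funext μ
      by_cases hv : μ.rng = v
      · rw [opP_of_eq _ hv, opP_of_ne _ (hv ▸ h)]
        rfl
      · exact opP_of_ne _ hv)
  S_mul p q := Submodule.linearMap_qext _ <| LinearMap.ext fun f =>
    congrArg (Λ.vanishing K).mkQ (opS_mul Λ p q f)
  Sst_mul p q := Submodule.linearMap_qext _ <| LinearMap.ext fun f =>
    congrArg (Λ.vanishing K).mkQ (opSst_mul p q f)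
  P_mul_S p := Submodule.linearMap_qext _ <| LinearMap.ext fun f =>
    congrArg (Λ.vanishing K).mkQ (opP_opS p f)
  S_mul_P p := Submodule.linearMap_qext _ <| LinearMap.ext fun f =>
    congrArg (Λ.vanishing K).mkQ (opS_opP Λ p f)
  P_mul_Sst p := Submodule.linearMap_qext _ <| LinearMap.ext fun f =>
    congrArg (Λ.vanishing K).mkQ (opP_opSst p f)
  Sst_mul_P p := Submodule.linearMap_qext _ <| LinearMap.ext fun f =>
    congrArg (Λ.vanishing K).mkQ (opSst_opP p f)
  Sst_mul_S_self p := Submodule.linearMap_qext _ <| LinearMap.ext fun f =>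
    congrArg (Λ.vanishing K).mkQ (opSst_opS Λ p f)
  Sst_mul_S_ne p q hd h := Submodule.linearMap_qext _ <| LinearMap.ext fun f =>
    congrArg (Λ.vanishing K).mkQ (opSst_opS_of_ne hd h f)
  P_eq_sum v n := Submodule.linearMap_qext _ <| LinearMap.ext fun f => by
    rw [finsum_mem_eq_finite_toFinset_sum _ (hfin v n)]
    have := (Submodule.Quotient.eq _).2 (opP_sub_sum_mem hfin v n f)
    refine this.trans ?_
    change (Λ.vanishing K).mkQ _ = _
    rw [map_sum, LinearMap.comp_apply, LinearMap.sum_apply]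
    rfl

variable {K}

/-- P_v does not kill the germ of the constant 1, as there are paths of every degree into v. -/
theorem P_ne_zero (hfin : Λ.RowFinite) (hsrc : Λ.NoSources) (v : V) :
    (Λ.kpFamily K hfin).P v ≠ 0 := by
  obtain ⟨φ, ⟨hP, -, -⟩, -⟩ := Λ.kumjianPask_universal K hfin (Λ.germFamily K hfin)
  intro h
  have h1 := hP v
  rw [h, map_zero] at h1
  have h2 := LinearMap.congr_fun h1 ((Λ.vanishing K).mkQ fun _ => 1)
  obtain ⟨n, hn⟩ := (Submodule.Quotient.mk_eq_zero _).1 (show (Λ.vanishing K).mkQ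
    (opP K v fun _ => 1) = 0 from h2.symm)
  obtain ⟨μ, hμ⟩ := hsrc v n
  have := hn μ hμ.2.ge
  rw [opP_of_eq _ hμ.1] at this
  exact one_ne_zero this

end Representation

/-! ### Necessity of the leaf conditions -/

theorem leafBound_of_isSemisimple (hfin : Λ.RowFinite) (hsrc : Λ.NoSources) {K : Type*} [Field K]
    (h : IsSemisimpleNonUnital (Λ.KumjianPask K)) : Λ.LeafBound := by
  set F := Λ.kpFamily K hfin with hF
  intro v₀
  by_contra hv₀
  -- Call a vertex bad if it violates the bound, and take a minimal s_l s_{l*} with bad source w. As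
  -- w is no leaf, some degree has a path μ into w with bad source and another path ν; extending l
  -- by μ will contradict minimality.
  obtain ⟨_, ⟨⟨w, b, l⟩, hw, rfl⟩, hmin⟩ := h.exists_minimal (q₀ := F.S (GPath.of (𝟙 v₀)) *
      F.Sst (GPath.of (𝟙 v₀)))
    (Q := fun q => ∃ l : GPath V, (¬ ∃ n : Fin k → ℕ, ∀ p ∈ Λ.pathsTo l.src n, p.src ∈ Λ.leaves) ∧
      q = F.S l * F.Sst l)
    (by
      rintro _ ⟨l, -, rfl⟩
      rw [← mul_assoc, F.S_mul_Sst_mul_S])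
    ⟨GPath.of (𝟙 v₀), hv₀, rfl⟩
  have hleaf : w ∉ Λ.leaves := fun hl => hw ⟨0, fun p hp => by
    rw [pathsTo_zero] at hp
    subst hp
    exact hl⟩
  obtain ⟨ν₁, ν₂, hν₁, hν₂, hd, hne⟩ : ∃ p q : GPath V, p.rng = w ∧ q.rng = w ∧
      Λ.degree p = Λ.degree q ∧ p ≠ q := by
    by_contra! hcon
    exact hleaf (mem_leaves_of_unique hsrc hcon)
  obtain ⟨⟨c, w', μ⟩, hμ, hbad⟩ : ∃ μ ∈ Λ.pathsTo w (Λ.degree ν₁),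
      ¬ ∃ n : Fin k → ℕ, ∀ p ∈ Λ.pathsTo μ.src n, p.src ∈ Λ.leaves := by
    by_contra! hcon
    refine hw (saturated_of_leafBound hfin hsrc w (Λ.degree ν₁) ?_)
    rintro _ ⟨μ, hμ, rfl⟩
    exact hcon μ hμ
  obtain rfl : w' = w := hμ.1
  obtain ⟨ν, hν, hνμ⟩ : ∃ ν ∈ Λ.pathsTo w' (Λ.degree ν₁), ν ≠ GPath.of μ := by
    by_cases h1 : ν₁ = GPath.of μ
    · exact ⟨ν₂, ⟨hν₂, hd.symm⟩, fun h2 => hne (h1.trans h2.symm)⟩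
    · exact ⟨ν₁, ⟨hν₁, rfl⟩, h1⟩
  have hq := hmin _ ⟨GPath.of (μ ≫ l), hbad, rfl⟩
  change _ * (F.S (GPath.of l) * F.Sst (GPath.of l)) = _ →
    F.S (GPath.of l) * F.Sst (GPath.of l) * _ = F.S (GPath.of l) * F.Sst (GPath.of l) at hq
  rw [F.S_comp, F.Sst_comp] at hq
  have hl : F.Sst (GPath.of l) * F.S (GPath.of l) = F.P w' := F.Sst_mul_S_self (GPath.of l)
  have e1 : F.S (GPath.of l) * F.S (GPath.of μ) * (F.Sst (GPath.of μ) * F.Sst (GPath.of l)) *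
      (F.S (GPath.of l) * F.Sst (GPath.of l)) =
      F.S (GPath.of l) * F.S (GPath.of μ) * (F.Sst (GPath.of μ) * F.Sst (GPath.of l)) := by
    rw [mul_assoc, mul_assoc (F.Sst (GPath.of μ)), ← mul_assoc (F.Sst (GPath.of l)), hl,
      F.P_mul_Sst_of]
  -- Conjugating by s_l turns minimality into s_μ s_{μ*} = P_w, whence s_ν = 0.
  have e2 := congrArg (fun x => F.Sst (GPath.of l) * x * F.S (GPath.of l)) (hq e1)
  have e3 : F.P w' * (F.S (GPath.of μ) * F.Sst (GPath.of μ)) * F.P w' = F.P w' * F.P w' := by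
    rw [← hl]
    simp only [mul_assoc] at e2 ⊢
    have e4 (x : Λ.KumjianPask K) : F.Sst (GPath.of l) * (F.S (GPath.of l) *
        (F.Sst (GPath.of l) * x)) = F.Sst (GPath.of l) * x := by
      rw [← mul_assoc, ← mul_assoc, F.Sst_mul_S_mul_Sst]
    simp only [e4] at e2 ⊢
    exact e2
  rw [← mul_assoc, F.P_mul_S_of, mul_assoc, F.Sst_of_mul_P, F.P_mul_self] at e3
  have e5 : F.S ν = 0 := by
    have : F.P w' * F.S ν = F.S ν := hν.1 ▸ F.P_mul_S ν
    rw [← this, ← e3, mul_assoc, F.Sst_mul_S_ne (GPath.of μ) ν (hμ.2.trans hν.2.symm) (Ne.symm hνμ), mul_zero]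
  refine P_ne_zero (K := K) hfin hsrc ν.src ?_
  rw [← hF, ← F.Sst_mul_S_self, e5, mul_zero]

open Classical in
/-- A function of the degree, on the paths with range `v`. -/
noncomputable def degreeFun (Λ : KGraph k V) {K : Type*} [Field K] (v : V)
    (G : (Fin k → ℕ) → K) (μ : GPath V) : K :=
  if μ.rng = v then G (Λ.degree μ) else 0

/-- Every path of degree at least d(γ) into the leaf v begins with γ, and exchanging γ for δ
translates the degree by d(δ) - d(γ). -/
theorem opS_opSst_degreeFun {K : Type*} [Field K] {v : V} (hv : v ∈ Λ.leaves) {a : V}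
    (γ δ : a ⟶ v) (G : (Fin k → ℕ) → K) {μ : GPath V} (hμ : Λ.deg γ ≤ Λ.degree μ) :
    opS K (GPath.of γ) (opSst K (GPath.of δ) (Λ.degreeFun v G)) μ =
      Λ.degreeFun v (fun n => G (n - Λ.deg γ + Λ.deg δ)) μ := by
  by_cases h : μ.rng = v
  · subst h
    obtain ⟨c, g, r, hr, hg, hrd⟩ := exists_factor μ (add_tsub_cancel_of_le hμ).symm
    have hgγ : GPath.of g = GPath.of γ := eq_of_mem_leaves (Λ := Λ) hv rfl hg
    obtain rfl : c = a := congrArg GPath.src hgγ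
    obtain rfl : g = γ := of_inj.1 hgγ
    have h1 := opS_of' Λ g (opSst K (GPath.of δ) (Λ.degreeFun μ.rng G)) r
    rw [opSst_of', ← hr] at h1
    rw [h1]
    refine (if_pos rfl).trans (Eq.trans ?_ (if_pos rfl).symm)
    rw [degree_of, Λ.deg_comp, hrd, add_comm]
  · rw [opS_of_not _ (fun h' => h (rng_eq_of_extends h'))]
    exact (if_neg h).symm

/-- With z = s_γ s_{δ*}, the element x = P_v - z kills the constant germ 1 but maps some germ G to
-1. As P_v A preserves the line of constants, xyx kills G for every y, so x is not regular. -/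
theorem KPFamily.not_isSemisimple_of_lt (hfin : Λ.RowFinite) (hsrc : Λ.NoSources) {K : Type*}
    [Field K] {A : Type*} [NonUnitalRing A] [Module K A] [IsScalarTower K A A] [SMulCommClass K A A]
    (F : Λ.KPFamily A) (hspan : F.spanSSst K = ⊤) (φ : A →ₙₐ[K] Module.End K (Λ.PathGerm K))
    (hP : ∀ v, φ (F.P v) = (Λ.germFamily K hfin).P v)
    (hS : ∀ p, φ (F.S p) = (Λ.germFamily K hfin).S p)
    (hSst : ∀ p, φ (F.Sst p) = (Λ.germFamily K hfin).Sst p)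
    {v a : V} (hv : v ∈ Λ.leaves) (γ δ : a ⟶ v) {i : Fin k} (hi : Λ.deg γ i < Λ.deg δ i) :
    ¬ IsSemisimpleNonUnital A := by
  intro hss
  let π := (Λ.vanishing K).mkQ
  have hPG (G : (Fin k → ℕ) → K) : φ (F.P v) (π (Λ.degreeFun v G)) = π (Λ.degreeFun v G) := by
    rw [hP]
    change π (opP K v (Λ.degreeFun v G)) = _
    congr 1
    funext μ
    by_cases h : μ.rng = v
    · rw [opP_of_eq _ h]
    · rw [opP_of_ne _ h]
      exact (if_neg h).symm
  have hSG (b : V) (α β : b ⟶ v) (G G' : (Fin k → ℕ) → K)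
      (hG : ∀ n, Λ.deg α ≤ n → G (n - Λ.deg α + Λ.deg β) = G' n) :
      φ (F.S (GPath.of α) * F.Sst (GPath.of β)) (π (Λ.degreeFun v G)) =
        π (Λ.degreeFun v G') := by
    rw [map_mul, hS, hSst]
    change π (opS K _ (opSst K _ _)) = _
    refine (Submodule.Quotient.eq _).2 ⟨Λ.deg α, fun μ hμ => ?_⟩
    rw [Pi.sub_apply, opS_opSst_degreeFun hv α β G hμ, sub_eq_zero, degreeFun, degreeFun, hG _ hμ]
  set one := π (Λ.degreeFun v fun _ => 1) with hone
  set z := F.S (GPath.of γ) * F.Sst (GPath.of δ) with hz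
  have hone0 : one ≠ 0 := by
    intro h0
    obtain ⟨n, hn⟩ := (Submodule.Quotient.mk_eq_zero _).1 h0
    obtain ⟨μ, hμ⟩ := hsrc v n
    have := hn μ hμ.2.ge
    rw [degreeFun, if_pos hμ.1] at this
    exact one_ne_zero this
  obtain ⟨D, hD0, hD⟩ : ∃ D : ℕ, 0 < D ∧ Λ.deg δ i = Λ.deg γ i + D :=
    ⟨Λ.deg δ i - Λ.deg γ i, by omega, by omega⟩
  -- Translating the i-th coordinate by D raises the floor of n_i / D by exactly 1, so zG = G + 1 in
  -- every characteristic.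
  let G : (Fin k → ℕ) → K := fun n => ((n i / D : ℕ) : K)
  have hzG : φ z (π (Λ.degreeFun v G)) = π (Λ.degreeFun v G) + one := by
    rw [hSG a γ δ G (fun n => G n + 1), hone, ← map_add]
    · congr 1
      funext μ
      by_cases h : μ.rng = v <;> simp [degreeFun, h]
    · intro n hn
      have hn' : Λ.deg γ i ≤ n i := hn i
      have : (n - Λ.deg γ + Λ.deg δ) i = n i + D := by
        simp only [Pi.add_apply, Pi.sub_apply]
        omega
      simp only [G, this, Nat.add_div_right _ hD0, Nat.cast_succ]
  have hzP : z * F.P v = z := by rw [hz, mul_assoc, F.Sst_of_mul_P]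
  have hPz : F.P v * z = z := by rw [hz, ← mul_assoc, F.P_mul_S_of]
  set x := F.P v - z with hx
  have hxP : x * F.P v = x := by rw [hx, sub_mul, hzP, F.P_mul_self]
  have hPx : F.P v * x = x := by rw [hx, mul_sub, hPz, F.P_mul_self]
  obtain ⟨y, hy⟩ := hss.exists_mul_mul_eq hxP hPx
  have hx1 : φ x one = 0 := by
    rw [hx, map_sub, LinearMap.sub_apply, hPG, hSG a γ δ _ (fun _ => 1) (fun _ _ => rfl), sub_self]
  have hxG : φ x (π (Λ.degreeFun v G)) = -one := by
    rw [hx, map_sub, LinearMap.sub_apply, hPG, hzG]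
    abel
  -- Each P_v s_α s_{β*} fixes the constant germ if both ranges are v, and kills it otherwise.
  have hyc : ∃ c : K, φ (F.P v * y) one = c • one := by
    have hy : y ∈ F.spanSSst K := by rw [hspan]; trivial
    clear * - hy hPG hSG hone
    induction hy using Submodule.span_induction with
    | mem y hy =>
      obtain ⟨b, c, d, α, β, rfl⟩ := hy
      by_cases hc : c = v
      · by_cases hd : d = v
        · subst hc hd
          refine ⟨1, ?_⟩
          rw [← mul_assoc, F.P_mul_S_of, hSG b α β _ (fun _ => 1) (fun _ _ => rfl), one_smul]
        · refine ⟨0, ?_⟩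
          rw [hone, ← hPG, ← Module.End.mul_apply, ← map_mul, mul_assoc, mul_assoc,
            F.Sst_mul_P_of_ne hd]
          simp
      · refine ⟨0, ?_⟩
        rw [← mul_assoc, F.P_mul_S_of_ne (Ne.symm hc)]
        simp
    | zero => exact ⟨0, by simp⟩
    | add y z _ _ hy hz =>
      obtain ⟨c, hc⟩ := hy
      obtain ⟨d, hd⟩ := hz
      exact ⟨c + d, by rw [mul_add, map_add, LinearMap.add_apply, hc, hd, add_smul]⟩
    | smul r y _ hy =>
      obtain ⟨c, hc⟩ := hy
      exact ⟨r * c, by rw [mul_smul_comm, map_smul, LinearMap.smul_apply, hc, mul_smul]⟩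
  obtain ⟨c, hc⟩ := hyc
  have h1 : φ (x * y * x) (π (Λ.degreeFun v G)) = φ x (π (Λ.degreeFun v G)) := by rw [hy]
  rw [map_mul, Module.End.mul_apply, hxG, map_neg, neg_inj, ← hxP, mul_assoc, map_mul,
    Module.End.mul_apply, hc, map_smul, hx1, smul_zero] at h1
  exact hone0 h1.symm

/-- Paths of equal degree into a leaf agree, so a failure of rigidity shows in some coordinate of
the degree. -/
theorem rigidLeaves_of_isSemisimple (hfin : Λ.RowFinite) (hsrc : Λ.NoSources) {K : Type*} [Field K]
    (h : IsSemisimpleNonUnital (Λ.KumjianPask K)) : Λ.RigidLeaves := by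
  obtain ⟨φ, ⟨hP, hS, hSst⟩, -⟩ := Λ.kumjianPask_universal K hfin (Λ.germFamily K hfin)
  have key {v a : V} (hv : v ∈ Λ.leaves) (γ δ : a ⟶ v) {i : Fin k}
      (hi : Λ.deg γ i < Λ.deg δ i) : ¬ IsSemisimpleNonUnital (Λ.KumjianPask K) :=
    (Λ.kpFamily K hfin).not_isSemisimple_of_lt hfin hsrc (spanSSst_kpFamily hfin K) φ hP hS hSst
      hv γ δ hi
  rintro ⟨a, v, γ⟩ ⟨a', v', δ⟩ hv (rfl : v = v') (rfl : a = a')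
  refine eq_of_mem_leaves hv rfl ?_
  change Λ.deg γ = Λ.deg δ
  funext i
  rcases lt_trichotomy (Λ.deg γ i) (Λ.deg δ i) with hi | hi | hi
  · exact absurd h (key hv γ δ hi)
  · exact hi
  · exact absurd h (key hv δ γ hi)

theorem isSemisimple_iff (hfin : Λ.RowFinite) (hsrc : Λ.NoSources) (K : Type*) [Field K] :
    IsSemisimpleNonUnital (Λ.KumjianPask K) ↔ Λ.LeafBound ∧ Λ.RigidLeaves :=
  ⟨fun h => ⟨leafBound_of_isSemisimple hfin hsrc h, rigidLeaves_of_isSemisimple hfin hsrc h⟩,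
    fun h => (Λ.kpFamily K hfin).isSemisimple_of_leafBound hfin h.1 h.2
      (spanSSst_kpFamily hfin K)⟩

end KGraph

/-! ### The equivalence -/

theorem mainTheorem4 {k : ℕ} (hk : 0 < k) {V : Type u} [CategoryTheory.Category.{w} V]
    (Λ : KGraph k V) (hfin : Λ.RowFinite) (hsrc : Λ.NoSources) (𝕜 : Type*) [Field 𝕜] :
    List.TFAE [
      IsSemisimpleNonUnital (Λ.KumjianPask 𝕜),
      IsAtomicMonoid Λ.TMonoid ∧ ActsFreely (Multiplicative (Fin k → ℤ)) Λ.TMonoid,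
      IsAtomicMonoid Λ.TMonoid ∧
        ∀ a : Λ.TMonoid, AddIrreducible a → IsAperiodicElt (Multiplicative (Fin k → ℤ)) a,
      Λ.hsClosure Λ.leaves = Set.univ ∧ Λ.Aperiodic] := by
  tfae_have 1 ↔ 4 :=
    (KGraph.isSemisimple_iff hfin hsrc 𝕜).trans (KGraph.hsClosure_aperiodic_iff hfin hsrc).symm
  tfae_have 3 ↔ 4 := by
    rw [KGraph.hsClosure_aperiodic_iff hfin hsrc, KGraph.isAtomicMonoid_iff hfin hsrc,
      KGraph.atoms_aperiodic_iff hfin hsrc]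
  tfae_have 2 → 3 := fun h => ⟨h.1, fun a ha =>
    ⟨fun h0 => ha.1 (h0 ▸ isAddUnit_zero), h.2 a⟩⟩
  tfae_have 3 → 2 := fun h => ⟨h.1, KGraph.actsFreely_of_atomic hfin hsrc h.1 h.2⟩
  tfae_finish
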